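/- **Setting.** Let $N_1,N_2$ be compact finite-dimensional Riemannian manifolds (possibly with boundary), $\operatorname{diam}N_2=1$ for the Riemannian distance $d_2$, let $m_1$ be the Riemannian volume of $N_1$ normalized to $m_1(N_1)=1$, and $\Sigma=N_1\times N_2$. Let $F(x,y)=(T(x),G(x,y))$ with $T:N_1\to N_1$ and $G:\Sigma\to N_2$ measurable. Let $P_T$ be the Perron–Frobenius operator of $T$ on $L^1(m_1)$, i.e. $\int \psi\,P_T\varphi\,dm_1=\int(\psi\circ T)\varphi\,dm_1$ for $\varphi\in L^1(m_1)$, $\psi\in L^\infty(m_1)$. Write $|\cdot|_1$ for the norm of $L^1(m_1)$. Assume: * **(G1)** there is $0<\alpha<1$ with $d_2(G(x,y_1),G(x,y_2))\le\alpha\, d_2(y_1,y_2)$ for all $x\in N_1$, $y_1,y_2\in N_2$; * **(T1)** $m_1(A)=0$ implies $m_1(T^{-1}(A))=0$; * **(T2)** there are finitely many pairwise disjoint open sets $P_1,\dots,P_q\subseteq N_1$ with $m_1(\bigcup_i P_i)=1$ such that each $T|_{P_i}$ is a $C^1$ diffeomorphism onto its image with $\det DT\ne0$ on $P_i$; * **(T3.1)**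 there is a real Banach space $(S_-,|\cdot|_s)$, a linear subspace of $L^1(m_1)$, with $|\cdot|_1\le|\cdot|_s$, which is $P_T$-invariant and on which $P_T$ is bounded; * **(T3.2)** the unit ball of $S_-$ is relatively compact in $L^1(m_1)$; * **(T3.3)** there are an integer $k\ge1$, $0<\beta_0<1$ and $C>0$ with $|P_T^kf|_s\le\beta_0|f|_s+C|f|_1$ for all $f\in S_-$; * **(T3.4)** there is a unique $\psi_x\in S_-$ with $\psi_x\ge0$, $|\psi_x|_1=1$, $P_T\psi_x=\psi_x$, and for every $\psi\in S_-$ with $\psi\ge0$, $|\psi|_1=1$ one has $P_T^n(\psi_x-\psi)\to0$ in $S_-$ as $n\to\infty$; * **(S)** the nonnegative elements of $S_-$ span a dense linear subspace of $S_-$ (this holds e.g. if $f\in S_-$ implies $|f|\in S_-$). **The space $S^1$.** For finite measures $\mu,\nu$ on $N_2$ let $W_1^0(\mu,\nu)=\sup|\int g\,d\mu-\int g\,d\nu|$, over all $g:N_2\to\mathbb R$ with $\operatorname{Lip}(g)\le1$ and $\|g\|_\infty\le1$. Let $\mu$ be a signed Borel measure on $\Sigma$ with Jordan decomposition $\mu=\mu^+-\mu^-$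 such that the marginals of $\mu^\pm$ on $N_1$ are absolutely continuous with respect to $m_1$, with densities $\phi_x^\pm$. Put $\phi_x=\phi_x^+-\phi_x^-$ and $\mu^\pm|_\gamma=\phi_x^\pm(\gamma)\,\mu^\pm_\gamma$, where $(\mu^\pm_\gamma)_{\gamma\in N_1}$ is the disintegration of $\mu^\pm$ into probability measures on the fibres $\{\gamma\}\times N_2\cong N_2$, and let $\|\mu\|_1=\int_{N_1}W_1^0(\mu^+|_\gamma,\mu^-|_\gamma)\,dm_1(\gamma)$. The space $S^1$ consists of those $\mu$ for which $\|\mu\|_1<\infty$ and $\phi_x\in S_-$, and $\|\mu\|_{S^1}=|\phi_x|_s+\|\mu\|_1$. **Theorem.** The transfer operator $F^*$, $[F^*\mu](E)=\mu(F^{-1}(E))$, maps $S^1$ to itself and can be written as $F^*=P+N$ with linear operators $P,N:S^1\to S^1$ such that * (a) $P^2=P$ and $\dim\operatorname{Im}P=1$; * (b) there are $0<\xi<1$ and $K>0$ with $\|N^n\mu\|_{S^1}\le K\,\xi^n\,\|\mu\|_{S^1}$ for all $\mu\in S^1$ and $n\ge0$; * (c) $PN=NP=0$. More precisely, there are $0<r<1$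 and $D>0$ such that $|P_T^n\varphi|_s\le D\,r^n|\varphi|_s$ for all $n\ge0$ and all $\varphi\in S_-$ with $\int\varphi\,dm_1=0$; and for every such pair $(r,D)$, (b) holds, for a suitable $K$, with $\xi=\sqrt{\max\{\lambda,\beta_1\}}$, where $\lambda=\beta_0^{1/k}$ and $\beta_1=\max\{\sqrt\alpha,\sqrt r\}$. -/

import Mathlib

open MeasureTheory Set Filter Topology Manifold ProbabilityTheory Bundle
open scoped ENNReal ContDiff

noncomputable section

namespace SkewProduct

/-! ### Riemannian volume and Jacobian -/

section Volume

variable {n : ℕ} {H : Type*} [TopologicalSpace H]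
  (I : ModelWithCorners ℝ (EuclideanSpace ℝ (Fin n)) H)
  {M : Type*} [TopologicalSpace M] [ChartedSpace H M]
  [RiemannianBundle (fun x : M ↦ TangentSpace I x)]

/-- The `n`-dimensional volume, in the inner product space `T_x M`, of the parallelepiped spanned
by `n` tangent vectors: the square root of their Gram determinant. -/
def gramVolume {x : M} (v : Fin n → TangentSpace I x) : ℝ :=
  Real.sqrt (Matrix.det (Matrix.of fun i j ↦ inner ℝ (v i) (v j)))

/-- The coordinate frame `∂₁, …, ∂ₙ` of the chart centred at `c`, at the point with
coordinates `u`. -/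
def chartFrame (c : M) (u : EuclideanSpace ℝ (Fin n)) (i : Fin n) :
    TangentSpace I ((extChartAt I c).symm u) :=
  mfderivWithin 𝓘(ℝ, EuclideanSpace ℝ (Fin n)) I (extChartAt I c).symm (range I) u
    (EuclideanSpace.single i (1 : ℝ) : EuclideanSpace ℝ (Fin n))

/-- The Riemannian volume on the domain of the chart centred at `c`, that is
`√(det g_ij) du₁ ⋯ duₙ` in these coordinates (extended by zero outside the domain). -/
def chartVolume [MeasurableSpace M] (c : M) : Measure M :=
  Measure.map (extChartAt I c).symm
    ((volume.restrict (extChartAt I c).target).withDensity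
      fun u ↦ ENNReal.ofReal (gramVolume I (chartFrame I c u)))

/-- The Riemannian volume measure. The measures `chartVolume I c` agree on the overlaps of the
charts, and their supremum in the lattice of measures is the measure which restricts to
`chartVolume I c` on the domain of the chart centred at `c`, for every `c`. -/
def riemannianVolume (M : Type*) [TopologicalSpace M] [ChartedSpace H M]
    [RiemannianBundle (fun x : M ↦ TangentSpace I x)] [MeasurableSpace M] : Measure M :=
  ⨆ c : M, chartVolume I c

/-- The Riemannian volume, normalized to have total mass one. -/
def normalizedVolume (M : Type*) [TopologicalSpace M] [ChartedSpace H M]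
    [RiemannianBundle (fun x : M ↦ TangentSpace I x)] [MeasurableSpace M] : Measure M :=
  (riemannianVolume I M univ)⁻¹ • riemannianVolume I M

instance isFiniteMeasure_normalizedVolume (M : Type*) [TopologicalSpace M] [ChartedSpace H M]
    [RiemannianBundle (fun x : M ↦ TangentSpace I x)] [MeasurableSpace M] :
    IsFiniteMeasure (normalizedVolume I M) := by
  refine ⟨lt_of_le_of_lt ?_ ENNReal.one_lt_top⟩
  simp only [normalizedVolume, Measure.smul_apply, smul_eq_mul]
  exact ENNReal.inv_mul_le_one (riemannianVolume I M univ)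

/-- The absolute value `|det DT(x)|` of the Jacobian determinant of `T` at `x` with respect to the
Riemannian metric: the factor by which `DT(x)` multiplies `n`-dimensional volumes. -/
def absJacobian (T : M → M) (x : M) : ℝ :=
  gramVolume I (fun i ↦ mfderiv I I T x
      (EuclideanSpace.single i (1 : ℝ) : EuclideanSpace ℝ (Fin n))) /
    gramVolume I (x := x)
      (fun i ↦ (EuclideanSpace.single i (1 : ℝ) : EuclideanSpace ℝ (Fin n)))

/-- `T` restricted to the open set `U` is a (`C¹`) diffeomorphism onto its image, with nonvanishing
Jacobian determinant. -/
structure IsDiffeoBranch (T : M → M) (U : Set M) : Prop where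
  isOpen : IsOpen U
  contMDiffOn : ContMDiffOn I I 1 T U
  exists_inverse : ∃ S : M → M, LeftInvOn S T U ∧ ContMDiffOn I I 1 S (T '' U)
  jacobian_ne_zero : ∀ x ∈ U, absJacobian I T x ≠ 0

/-- Up to a null set, the manifold is a finite disjoint union of open sets on each of which `T` is
a diffeomorphism onto its image, with nonvanishing Jacobian determinant. -/
def IsPiecewiseDiffeo [MeasurableSpace M] (T : M → M) : Prop :=
  ∃ (q : ℕ) (P : Fin q → Set M), Pairwise (fun i j ↦ Disjoint (P i) (P j)) ∧
    normalizedVolume I M (⋃ i, P i) = 1 ∧ ∀ i, IsDiffeoBranch I T (P i)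

end Volume

/-! ### The Perron–Frobenius operator of the base map -/

section PerronFrobenius

variable {X : Type*} [MeasurableSpace X]

/-- The Perron–Frobenius operator `P_T` on `L¹(m)`: the density with respect to `m` of the
push-forward by `T` of the signed measure `φ m`. For a measurable nonsingular `T` it is
characterized by `∫ ψ · P_T φ dm = ∫ (ψ ∘ T) · φ dm` for all `ψ ∈ L^∞(m)`. -/
def perronFrobenius (m : Measure X) (T : X → X) (φ : Lp ℝ 1 m) : Lp ℝ 1 m :=
  (SignedMeasure.integrable_rnDeriv ((m.withDensityᵥ φ).map T) m).toL1 _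

end PerronFrobenius

/-! ### Spaces of signed measures on the product -/

section Marginals

variable {X Y : Type*} [MeasurableSpace X] [MeasurableSpace Y] (m : Measure X)

/-- The space `AB` of signed measures `μ` on `X × Y` such that the marginals on `X` of the positive
part and of the negative part of `μ` are absolutely continuous with respect to `m`. -/
def HasACMarginals (s : SignedMeasure (X × Y)) : Prop :=
  s.toJordanDecomposition.posPart.fst ≪ m ∧ s.toJordanDecomposition.negPart.fst ≪ m

/-- The marginal density `φ_x = φ_x⁺ - φ_x⁻` of a signed measure `μ`, where `φ_x^±` is the density
of the marginal of `μ^±`. -/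
def marginalDensity (s : SignedMeasure (X × Y)) (x : X) : ℝ :=
  (s.toJordanDecomposition.posPart.fst.rnDeriv m x).toReal -
    (s.toJordanDecomposition.negPart.fst.rnDeriv m x).toReal

variable {m}

theorem apply_eq (s : SignedMeasure (X × Y)) {A : Set (X × Y)} (hA : MeasurableSet A) :
    s A = s.toJordanDecomposition.posPart.real A - s.toJordanDecomposition.negPart.real A :=
  s.apply_eq_posPart_real_sub_negPart_real hA

/-- A signed measure has absolutely continuous marginals iff it vanishes on every measurable
subset of a strip over a null set. -/
theorem hasACMarginals_iff (s : SignedMeasure (X × Y)) :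
    HasACMarginals m s ↔ ∀ A : Set X, MeasurableSet A → m A = 0 →
      ∀ E : Set (X × Y), MeasurableSet E → E ⊆ Prod.fst ⁻¹' A → s E = 0 := by
  constructor
  · rintro ⟨hp, hn⟩ A hA hmA E hE hEA
    have h1 := hp hmA
    have h2 := hn hmA
    rw [Measure.fst_apply hA] at h1 h2
    rw [apply_eq s hE, measureReal_def, measureReal_def, measure_mono_null hEA h1,
      measure_mono_null hEA h2, sub_self]
  · intro h
    obtain ⟨i, hi, h0, h1, hpi, hni⟩ := s.toJordanDecomposition_spec
    constructor
    · refine Measure.AbsolutelyContinuous.mk fun A hA hmA ↦ ?_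
      have hA' : MeasurableSet (Prod.fst ⁻¹' A : Set (X × Y)) := measurable_fst hA
      rw [Measure.fst_apply hA, hpi, SignedMeasure.toMeasureOfZeroLE_apply _ _ hi hA']
      simp [h A hA hmA _ (hi.inter hA') inter_subset_right]
    · refine Measure.AbsolutelyContinuous.mk fun A hA hmA ↦ ?_
      have hA' : MeasurableSet (Prod.fst ⁻¹' A : Set (X × Y)) := measurable_fst hA
      rw [Measure.fst_apply hA, hni, SignedMeasure.toMeasureOfLEZero_apply _ _ hi.compl hA']
      simp [h A hA hmA _ (hi.compl.inter hA') inter_subset_right]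

theorem HasACMarginals.zero : HasACMarginals m (0 : SignedMeasure (X × Y)) := by
  rw [hasACMarginals_iff]
  intros
  simp

theorem HasACMarginals.add {s t : SignedMeasure (X × Y)} (hs : HasACMarginals m s)
    (ht : HasACMarginals m t) : HasACMarginals m (s + t) := by
  rw [hasACMarginals_iff] at *
  intro A hA hmA E hE hEA
  simp [hs A hA hmA E hE hEA, ht A hA hmA E hE hEA]

theorem HasACMarginals.smul {s : SignedMeasure (X × Y)} (c : ℝ) (hs : HasACMarginals m s) :
    HasACMarginals m (c • s) := by
  rw [hasACMarginals_iff] at *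
  intro A hA hmA E hE hEA
  simp [hs A hA hmA E hE hEA]

theorem integrable_marginalDensity (s : SignedMeasure (X × Y)) :
    Integrable (marginalDensity m s) m :=
  Measure.integrable_toReal_rnDeriv.sub Measure.integrable_toReal_rnDeriv

/-- The marginal density is the density of the marginal of the signed measure. -/
theorem setIntegral_marginalDensity [SigmaFinite m] {s : SignedMeasure (X × Y)}
    (hs : HasACMarginals m s) {A : Set X} (hA : MeasurableSet A) :
    ∫ x in A, marginalDensity m s x ∂m = s (Prod.fst ⁻¹' A) := by
  unfold marginalDensity
  rw [integral_sub Measure.integrable_toReal_rnDeriv.integrableOn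
    Measure.integrable_toReal_rnDeriv.integrableOn, Measure.setIntegral_toReal_rnDeriv hs.1,
    Measure.setIntegral_toReal_rnDeriv hs.2, apply_eq s (measurable_fst hA), measureReal_def,
    measureReal_def, Measure.fst_apply hA, Measure.fst_apply hA]
  rfl

theorem marginalDensity_add [SigmaFinite m] {s t : SignedMeasure (X × Y)}
    (hs : HasACMarginals m s) (ht : HasACMarginals m t) :
    marginalDensity m (s + t) =ᵐ[m] marginalDensity m s + marginalDensity m t := by
  refine Integrable.ae_eq_of_forall_setIntegral_eq _ _ (integrable_marginalDensity _)
    ((integrable_marginalDensity s).add (integrable_marginalDensity t)) fun A hA _ ↦ ?_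
  simp only [Pi.add_apply]
  rw [integral_add (integrable_marginalDensity s).integrableOn
    (integrable_marginalDensity t).integrableOn, setIntegral_marginalDensity hs hA,
    setIntegral_marginalDensity ht hA, setIntegral_marginalDensity (hs.add ht) hA]
  simp

theorem marginalDensity_smul [SigmaFinite m] {s : SignedMeasure (X × Y)} (c : ℝ)
    (hs : HasACMarginals m s) :
    marginalDensity m (c • s) =ᵐ[m] c • marginalDensity m s := by
  refine Integrable.ae_eq_of_forall_setIntegral_eq _ _ (integrable_marginalDensity _)
    ((integrable_marginalDensity s).smul c) fun A hA _ ↦ ?_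
  simp only [Pi.smul_apply]
  rw [integral_smul, setIntegral_marginalDensity hs hA,
    setIntegral_marginalDensity (hs.smul c) hA]
  simp

theorem marginalDensity_zero [SigmaFinite m] :
    marginalDensity m (0 : SignedMeasure (X × Y)) =ᵐ[m] 0 := by
  have := marginalDensity_smul (m := m) (0 : ℝ) (HasACMarginals.zero (X := X) (Y := Y))
  simpa using this

end Marginals

section Spaces

/-- The Wasserstein–Kantorovich like distance of two finite measures: the supremum of
`|∫ g dμ - ∫ g dν|` over the functions `g` with Lipschitz constant and sup norm at most one. -/
def wDist {Y : Type*} [PseudoMetricSpace Y] [MeasurableSpace Y] (μ ν : Measure Y) : ℝ≥0∞ :=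
  ⨆ g : {g : Y → ℝ // LipschitzWith 1 g ∧ ∀ y, |g y| ≤ 1},
    ENNReal.ofReal |∫ y, g.1 y ∂μ - ∫ y, g.1 y ∂ν|

theorem wDist_le {Y : Type*} [PseudoMetricSpace Y] [MeasurableSpace Y] (μ ν : Measure Y) : wDist μ ν ≤ μ univ + ν univ := by
  refine iSup_le fun g ↦ ?_
  have key : ∀ ρ : Measure Y, ‖∫ y, g.1 y ∂ρ‖ₑ ≤ ρ univ := fun ρ ↦ by
    refine (enorm_integral_le_lintegral_enorm _).trans ?_
    calc ∫⁻ y, ‖g.1 y‖ₑ ∂ρ ≤ ∫⁻ _, 1 ∂ρ := lintegral_mono fun y ↦ by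
          rw [← ofReal_norm, ← ENNReal.ofReal_one]
          exact ENNReal.ofReal_le_ofReal (g.2.2 y)
      _ = ρ univ := by simp
  calc ENNReal.ofReal |∫ y, g.1 y ∂μ - ∫ y, g.1 y ∂ν|
      = ‖∫ y, g.1 y ∂μ - ∫ y, g.1 y ∂ν‖ₑ := by rw [← ofReal_norm, Real.norm_eq_abs]
    _ ≤ ‖∫ y, g.1 y ∂μ‖ₑ + ‖∫ y, g.1 y ∂ν‖ₑ := enorm_sub_le
    _ ≤ μ univ + ν univ := add_le_add (key μ) (key ν)

variable {X Y : Type*} [MeasurableSpace X] (m : Measure X)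
  [MetricSpace Y] [CompactSpace Y] [Nonempty Y] [MeasurableSpace Y] [BorelSpace Y]

/-- The restriction `μ|_γ = φ_x(γ) μ_γ` of a positive measure `μ` to the leaf `{γ} × Y`, seen as a
measure on `Y`: here `φ_x` is the density of the marginal of `μ` on `X` and `(μ_γ)_γ` is the
disintegration of `μ` into probability measures along the leaves. -/
def leafRestriction (μ : Measure (X × Y)) [IsFiniteMeasure μ] (γ : X) : Measure Y :=
  μ.fst.rnDeriv m γ • μ.condKernel γ

/-- The weak norm `‖μ‖₁ = ∫ W(μ⁺|_γ, μ⁻|_γ) dm(γ)`, with values in `[0, ∞]`. -/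
def weakNorm (s : SignedMeasure (X × Y)) : ℝ≥0∞ :=
  ∫⁻ γ, wDist (leafRestriction m s.toJordanDecomposition.posPart γ)
    (leafRestriction m s.toJordanDecomposition.negPart γ) ∂m

/-- The weak norm of every (finite) signed measure is finite. -/
theorem weakNorm_lt_top (s : SignedMeasure (X × Y)) : weakNorm m s < ⊤ := by
  have h : ∀ (μ : Measure (X × Y)) [IsFiniteMeasure μ] (γ : X),
      leafRestriction m μ γ univ = μ.fst.rnDeriv m γ := fun μ _ γ ↦ by
    simp [leafRestriction]
  calc weakNorm m s ≤ ∫⁻ γ, (s.toJordanDecomposition.posPart.fst.rnDeriv m γ +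
        s.toJordanDecomposition.negPart.fst.rnDeriv m γ) ∂m :=
        lintegral_mono fun γ ↦ (wDist_le _ _).trans (by rw [h, h])
    _ < ⊤ := by
        rw [lintegral_add_left (Measure.measurable_rnDeriv _ _)]
        exact ENNReal.add_lt_top.2 ⟨Measure.lintegral_rnDeriv_lt_top _ _,
          Measure.lintegral_rnDeriv_lt_top _ _⟩

/-! In the rest of this section, the strong space `S_ ⊆ L¹(m)` with norm `|·|_s` is given as a
normed space `B` with an injective linear map `ι : B → L¹(m)`. -/

variable {m} [SigmaFinite m] {B : Type*} [NormedAddCommGroup B] [NormedSpace ℝ B]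
  (ι : B →ₗ[ℝ] Lp ℝ 1 m)

variable (Y) in
/-- The space `S¹` of the signed measures `μ ∈ AB` with `‖μ‖₁ < ∞` whose marginal density `φ_x`
belongs to the strong space. -/
def S1 : Submodule ℝ (SignedMeasure (X × Y)) where
  carrier := {s | HasACMarginals m s ∧ weakNorm m s < ⊤ ∧
    ∃ f : B, (ι f : X → ℝ) =ᵐ[m] marginalDensity m s}
  zero_mem' := by
    refine ⟨HasACMarginals.zero, weakNorm_lt_top m _, 0, ?_⟩
    rw [map_zero]
    exact (Lp.coeFn_zero _ _ _).trans marginalDensity_zero.symm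
  add_mem' := by
    rintro s t ⟨hs, -, f, hf⟩ ⟨ht, -, g, hg⟩
    refine ⟨hs.add ht, weakNorm_lt_top m _, f + g, ?_⟩
    rw [map_add]
    exact (Lp.coeFn_add _ _).trans ((hf.add hg).trans (marginalDensity_add hs ht).symm)
  smul_mem' := by
    rintro c s ⟨hs, -, f, hf⟩
    refine ⟨hs.smul c, weakNorm_lt_top m _, c • f, ?_⟩
    rw [map_smul]
    exact (Lp.coeFn_smul _ _).trans ((hf.const_smul c).trans (marginalDensity_smul c hs).symm)

variable {ι}

/-- The marginal density `φ_x` of `μ ∈ S¹`, as an element of the strong space. -/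
def S1.density (μ : S1 Y ι) : B := μ.2.2.2.choose

theorem S1.density_spec (μ : S1 Y ι) :
    (ι (S1.density μ) : X → ℝ) =ᵐ[m] marginalDensity m (μ : SignedMeasure (X × Y)) :=
  μ.2.2.2.choose_spec

/-- The norm `‖μ‖_{S¹} = |φ_x|_s + ‖μ‖₁`. -/
def S1.norm (μ : S1 Y ι) : ℝ :=
  ‖S1.density μ‖ + (weakNorm m (μ : SignedMeasure (X × Y))).toReal

end Spaces

/-! ### The skew product -/

/-- The skew product `F(x, y) = (T(x), G(x, y))`. -/
def skewProduct {X Y : Type*} (T : X → X) (G : X × Y → Y) (p : X × Y) : X × Y := (T p.1, G p)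

/-- The restriction `L` of the Perron–Frobenius operator to the strong space contracts the
functions of zero average with rate `r`: `|P_T^n φ|_s ≤ D r^n |φ|_s` for all `n`. -/
def ZeroAverageDecay {X : Type*} [MeasurableSpace X] {m : Measure X} {B : Type*}
    [NormedAddCommGroup B] [NormedSpace ℝ B] (ι : B →ₗ[ℝ] Lp ℝ 1 m) (L : B →L[ℝ] B)
    (r D : ℝ) : Prop :=
  0 < r ∧ r < 1 ∧ 0 < D ∧ ∀ φ : B, ∫ x, ι φ x ∂m = 0 → ∀ n : ℕ, ‖(L ^ n) φ‖ ≤ D * r ^ n * ‖φ‖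

/-- An element of the strong space which is a probability density. -/
def IsDensity {X : Type*} [MeasurableSpace X] {m : Measure X} {B : Type*}
    [NormedAddCommGroup B] [NormedSpace ℝ B] (ι : B →ₗ[ℝ] Lp ℝ 1 m) (ψ : B) : Prop :=
  0 ≤ ι ψ ∧ ‖ι ψ‖ = 1

end SkewProduct

end

noncomputable section

namespace SkewProduct

/-! ### Contraction of the strong space -/

section StrongSpace

variable {X : Type*} [MeasurableSpace X] {m : Measure X} {B : Type*} [NormedAddCommGroup B]
  [NormedSpace ℝ B] {ι : B →ₗ[ℝ] Lp ℝ 1 m} {L : B →L[ℝ] B}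

/-! The transfer operator `F*` preserves total mass and fixes a probability measure `μ₀` in `S¹`.
Take `P μ = μ(Σ) μ₀` and `N = F* - P`. Then `N^n μ = F*^n (μ - μ(Σ) μ₀)` for `n ≥ 1`, so everything
reduces to exponential decay of `F*^n` on elements of zero mass.

Both halves of the norm decay there. The marginal density of `F* μ` is `P_T φ_x`, and zero mass
means zero average, so the strong norm decays like `r^n`. For the weak norm, duality
(`pairing_le_weakNorm`, `weakNorm_le`) turns `‖μ‖₁` into the supremum of `∫ g dμ` over measurable
`g` bounded by one and 1-Lipschitz along the fibres. Since the fibres have diameter at most one and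
are contracted by `α`, `g ∘ F = c(x) + α h` with `|c| ≤ 1` and `h` of the same class. The term `c`
sees only the marginal, whence `‖F* μ‖₁ ≤ α ‖μ‖₁ + |φ_x|₁` (`toReal_weakNorm_map_le`). Iteration
gives decay at every rate `ξ` with `α < ξ` and `r ≤ ξ`.

The rate `r` (`exists_zeroAverageDecay`) comes from compactness. Convergence to zero at each
function of zero average becomes uniform in `L¹` on the unit ball, through a finite net, and the
Lasota–Yorke inequality upgrades small `L¹` norm to small strong norm.

The measure `μ₀` (`exists_invariant_lift`) is the limit of the images of `ρ × δ`, where `ρ` is the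
invariant measure of `T` with density `ψ_x`. All these images have marginal `ρ`, so the terms `c`
cancel and successive differences shrink like `α^n` on test functions. The limit is built fibre by
fibre from the disintegrations. -/

theorem abs_integral_le_norm (f : Lp ℝ 1 m) : |∫ x, f x ∂m| ≤ ‖f‖ := by
  rw [L1.norm_eq_integral_norm]
  exact norm_integral_le_integral_norm (f : X → ℝ)

theorem integral_eq_norm_of_nonneg {f : Lp ℝ 1 m} (hf : 0 ≤ f) : ∫ x, f x ∂m = ‖f‖ := by
  rw [L1.norm_eq_integral_norm]
  refine integral_congr_ae ?_
  filter_upwards [(Lp.coeFn_nonneg f).2 hf] with x hx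
  exact (Real.norm_of_nonneg hx).symm

theorem integral_coeFn_add (f g : Lp ℝ 1 m) :
    ∫ x, (f + g) x ∂m = ∫ x, f x ∂m + ∫ x, g x ∂m := by
  rw [integral_congr_ae (Lp.coeFn_add f g)]
  exact integral_add (L1.integrable_coeFn f) (L1.integrable_coeFn g)

theorem integral_coeFn_smul (c : ℝ) (f : Lp ℝ 1 m) :
    ∫ x, (c • f) x ∂m = c * ∫ x, f x ∂m := by
  rw [integral_congr_ae (Lp.coeFn_smul c f)]
  exact integral_const_mul c _

variable (ι) in
/-- The integral, as a linear functional on the strong space. -/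
def average : B →ₗ[ℝ] ℝ where
  toFun f := ∫ x, ι f x ∂m
  map_add' f g := by rw [map_add, integral_coeFn_add]
  map_smul' c f := by rw [map_smul, integral_coeFn_smul]; rfl

theorem average_apply (f : B) : average ι f = ∫ x, ι f x ∂m := rfl

theorem abs_average_le (f : B) : |average ι f| ≤ ‖ι f‖ := abs_integral_le_norm _

theorem IsDensity.average_eq_one {ψ : B} (hψ : IsDensity ι ψ) : average ι ψ = 1 := by
  rw [average_apply, integral_eq_norm_of_nonneg hψ.1, hψ.2]

theorem norm_pow_apply_le_of_le (hcontr : ∀ f : B, ‖ι (L f)‖ ≤ ‖ι f‖) (n : ℕ) (f : B) :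
    ‖ι ((L ^ n) f)‖ ≤ ‖ι f‖ := by
  induction n with
  | zero => simp
  | succ n ih =>
    rw [pow_succ', mul_apply_eq_comp]
    exact (hcontr _).trans ih

theorem average_pow_apply (hint : ∀ f : B, average ι (L f) = average ι f) (n : ℕ) (f : B) :
    average ι ((L ^ n) f) = average ι f := by
  induction n with
  | zero => simp
  | succ n ih => rw [pow_succ', mul_apply_eq_comp, hint, ih]

/-- The weak norm does not grow under `L`, so the Lasota–Yorke inequality can be iterated; `C / (1 -
β)` is the fixed point of `x ↦ β x + C`, the sum of the geometric series of errors. -/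
theorem norm_pow_mul_apply_le {k : ℕ} {β C : ℝ} (hβ : 0 < β) (hβ1 : β < 1)
    (hC : 0 < C) (hLY : ∀ f : B, ‖(L ^ k) f‖ ≤ β * ‖f‖ + C * ‖ι f‖)
    (hcontr : ∀ f : B, ‖ι (L f)‖ ≤ ‖ι f‖) (j : ℕ) (f : B) :
    ‖(L ^ (k * j)) f‖ ≤ β ^ j * ‖f‖ + C / (1 - β) * ‖ι f‖ := by
  have h1 : 0 < 1 - β := sub_pos.2 hβ1
  induction j with
  | zero => simpa using by positivity
  | succ j ih =>
    have h2 : L ^ (k * (j + 1)) = L ^ k * L ^ (k * j) := by rw [← pow_add]; ring_nf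
    rw [h2, mul_apply_eq_comp]
    have h3 : β * (C / (1 - β)) + C = C / (1 - β) := by field_simp; ring
    calc _ ≤ β * ‖(L ^ (k * j)) f‖ + C * ‖ι ((L ^ (k * j)) f)‖ := hLY _
      _ ≤ β * (β ^ j * ‖f‖ + C / (1 - β) * ‖ι f‖) + C * ‖ι f‖ := by
          gcongr
          exact norm_pow_apply_le_of_le hcontr _ _
      _ = β ^ (j + 1) * ‖f‖ + (β * (C / (1 - β)) + C) * ‖ι f‖ := by ring
      _ = _ := by rw [h3]

/-- Division of `n` by `k` leaves finitely many remainders, whose operator norms are absorbed in the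
sum `S`; multiples of `k` are handled by the iterated inequality. -/
theorem exists_norm_pow_apply_le {k : ℕ} (hk : 1 ≤ k) {β C : ℝ} (hβ : 0 < β) (hβ1 : β < 1)
    (hC : 0 < C) (hLY : ∀ f : B, ‖(L ^ k) f‖ ≤ β * ‖f‖ + C * ‖ι f‖)
    (hcontr : ∀ f : B, ‖ι (L f)‖ ≤ ‖ι f‖) (hle : ∀ f : B, ‖ι f‖ ≤ ‖f‖) :
    ∃ M : ℝ, 1 ≤ M ∧ ∀ (n : ℕ) (f : B), ‖(L ^ n) f‖ ≤ M * ‖f‖ := by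
  have h1 : 0 < 1 - β := sub_pos.2 hβ1
  set S : ℝ := ∑ i ∈ Finset.range k, ‖L ^ i‖
  have hS : 0 ≤ S := Finset.sum_nonneg fun _ _ ↦ norm_nonneg _
  refine ⟨max 1 ((1 + C / (1 - β)) * S), le_max_left _ _, fun n f ↦ ?_⟩
  have h2 : L ^ n = L ^ (k * (n / k)) * L ^ (n % k) := by
    rw [← pow_add, Nat.div_add_mod]
  have h3 : ‖(L ^ (n % k)) f‖ ≤ S * ‖f‖ := by
    refine ((L ^ (n % k)).le_opNorm f).trans ?_
    gcongr
    exact Finset.single_le_sum (f := fun i ↦ ‖L ^ i‖) (fun _ _ ↦ norm_nonneg _)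
      (Finset.mem_range.2 (Nat.mod_lt _ hk))
  rw [h2, mul_apply_eq_comp]
  calc _ ≤ β ^ (n / k) * ‖(L ^ (n % k)) f‖ + C / (1 - β) * ‖ι ((L ^ (n % k)) f)‖ :=
        norm_pow_mul_apply_le hβ hβ1 hC hLY hcontr _ _
    _ ≤ 1 * ‖(L ^ (n % k)) f‖ + C / (1 - β) * ‖(L ^ (n % k)) f‖ := by
        gcongr
        · exact pow_le_one₀ hβ.le hβ1.le
        · exact hle _
    _ = (1 + C / (1 - β)) * ‖(L ^ (n % k)) f‖ := by ring
    _ ≤ (1 + C / (1 - β)) * (S * ‖f‖) := by gcongr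
    _ = (1 + C / (1 - β)) * S * ‖f‖ := by ring
    _ ≤ _ := by gcongr; exact le_max_right _ _

/-- A uniformly bounded sequence of linear maps which converges to zero on a dense set converges to
zero everywhere. -/
theorem tendsto_zero_of_dense {A : ℕ → B →ₗ[ℝ] B} {M : ℝ} (hM : ∀ n f, ‖A n f‖ ≤ M * ‖f‖)
    {s : Set B} (hs : Dense s) (h : ∀ f ∈ s, Tendsto (fun n ↦ A n f) atTop (𝓝 0)) (f : B) :
    Tendsto (fun n ↦ A n f) atTop (𝓝 0) := by
  rw [Metric.tendsto_atTop]
  intro ε hε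
  obtain ⟨g, hg, hfg⟩ := Metric.mem_closure_iff.1 (hs f) (ε / (2 * (|M| + 1))) (by positivity)
  obtain ⟨n₀, hn₀⟩ := Metric.tendsto_atTop.1 (h g hg) (ε / 2) (half_pos hε)
  refine ⟨n₀, fun n hn ↦ ?_⟩
  have h1 := hn₀ n hn
  rw [dist_zero_right] at h1 ⊢
  have h2 : A n f = A n (f - g) + A n g := by rw [map_sub]; abel
  have h3 : ‖A n (f - g)‖ ≤ ε / 2 := by
    refine (hM n _).trans ?_
    rw [dist_eq_norm] at hfg
    calc M * ‖f - g‖ ≤ (|M| + 1) * (ε / (2 * (|M| + 1))) := by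
          gcongr
          linarith [le_abs_self M]
      _ = ε / 2 := by field_simp
  rw [h2]
  linarith [norm_add_le (A n (f - g)) (A n g)]

/-- The span of the nonnegative elements is dense in the whole space, which says nothing directly
about its zero-average part. Hence density is applied to the operators `f ↦ L^n f - (∫ f) ψ₀`,
defined everywhere and uniformly bounded; on zero-average functions the correction disappears. -/
theorem tendsto_pow_apply_of_average_eq_zero (hι : Function.Injective ι)
    (hle : ∀ f : B, ‖ι f‖ ≤ ‖f‖)
    {M : ℝ} (hM : ∀ (n : ℕ) (f : B), ‖(L ^ n) f‖ ≤ M * ‖f‖) {ψ₀ : B} (hLψ : L ψ₀ = ψ₀)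
    (hconv : ∀ ψ : B, IsDensity ι ψ → Tendsto (fun n : ℕ ↦ (L ^ n) (ψ₀ - ψ)) atTop (𝓝 0))
    (hS : Dense (Submodule.span ℝ {f : B | 0 ≤ ι f} : Set B)) {f : B} (hf : average ι f = 0) :
    Tendsto (fun n : ℕ ↦ (L ^ n) f) atTop (𝓝 0) := by
  have hLn : ∀ n : ℕ, (L ^ n) ψ₀ = ψ₀ := fun n ↦ by
    induction n with
    | zero => simp
    | succ n ih => rw [pow_succ', mul_apply_eq_comp, ih, hLψ]
  let A : ℕ → B →ₗ[ℝ] B := fun n ↦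
    (L ^ n : B →L[ℝ] B).toLinearMap - (average ι).smulRight ψ₀
  have hA : ∀ n f, A n f = (L ^ n) f - average ι f • ψ₀ := fun n f ↦ rfl
  have key := tendsto_zero_of_dense (A := A) (M := M + ‖ψ₀‖) (fun n f ↦ ?_) hS
    (fun f hf ↦ ?_) f
  · simpa [hA, hf] using key
  · rw [hA, add_mul]
    refine (norm_sub_le _ _).trans (add_le_add (hM n f) ?_)
    rw [norm_smul, mul_comm]
    gcongr
    exact (abs_average_le f).trans (hle f)
  · refine Submodule.span_induction (p := fun f _ ↦ Tendsto (fun n ↦ A n f) atTop (𝓝 0))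
      (fun f hf ↦ ?_) (by simp) (fun f g _ _ h1 h2 ↦ by simpa using h1.add h2)
      (fun c f _ h1 ↦ by simpa using h1.const_smul c) hf
    have hf : 0 ≤ ι f := hf
    by_cases h0 : ‖ι f‖ = 0
    · have : f = 0 := hι (by rw [norm_eq_zero.1 h0, map_zero])
      simp [this]
    · have hd : IsDensity ι (‖ι f‖⁻¹ • f) := by
        refine ⟨?_, ?_⟩
        · rw [map_smul, ← Lp.coeFn_nonneg]
          filter_upwards [Lp.coeFn_smul (‖ι f‖⁻¹) (ι f), (Lp.coeFn_nonneg _).2 hf] with x h1 h2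
          rw [h1]
          exact mul_nonneg (by positivity) h2
        · rw [map_smul, norm_smul, norm_inv, norm_norm, inv_mul_cancel₀ h0]
      -- With `a = ‖ι f‖ = ∫ f`, one has `L^n f - a ψ₀ = -a L^n (ψ₀ - f / a)`.
      have h1 := (hconv _ hd).const_smul (-‖ι f‖)
      rw [smul_zero] at h1
      refine h1.congr fun n ↦ ?_
      rw [hA, average_apply, integral_eq_norm_of_nonneg hf, map_sub, hLn, map_smul, smul_sub,
        smul_smul, neg_mul, mul_inv_cancel₀ h0]
      module

/-- Exponential contraction follows from contraction by one half at some time. -/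
theorem norm_pow_apply_le_geometric {M : ℝ} (hM1 : 1 ≤ M)
    (hM : ∀ (n : ℕ) (f : B), ‖(L ^ n) f‖ ≤ M * ‖f‖)
    (hint : ∀ f : B, average ι (L f) = average ι f) {p : ℕ} (hp : 1 ≤ p)
    (hhalf : ∀ f : B, average ι f = 0 → ‖(L ^ p) f‖ ≤ 1 / 2 * ‖f‖) :
    ∃ r D : ℝ, ZeroAverageDecay ι L r D := by
  set r : ℝ := (1 / 2 : ℝ) ^ (1 / (p : ℝ)) with hr
  have hp0 : (0 : ℝ) < p := by exact_mod_cast hp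
  have hr0 : 0 < r := by positivity
  have hr1 : r < 1 := Real.rpow_lt_one (by norm_num) (by norm_num) (by positivity)
  have hrp : r ^ p = 1 / 2 := by
    rw [hr, ← Real.rpow_natCast, ← Real.rpow_mul (by norm_num), one_div_mul_cancel hp0.ne',
      Real.rpow_one]
  refine ⟨r, 2 * M, hr0, hr1, by positivity, fun f hf n ↦ ?_⟩
  rw [← average_apply] at hf
  have h1 : ∀ j : ℕ, ‖(L ^ (p * j)) f‖ ≤ (1 / 2) ^ j * ‖f‖ := fun j ↦ by
    induction j with
    | zero => simp
    | succ j ih =>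
      have h2 : L ^ (p * (j + 1)) = L ^ p * L ^ (p * j) := by rw [← pow_add]; ring_nf
      rw [h2, mul_apply_eq_comp]
      refine (hhalf _ (by rw [average_pow_apply hint, hf])).trans ?_
      rw [pow_succ']
      linarith
  have h2 : L ^ n = L ^ (n % p) * L ^ (p * (n / p)) := by
    rw [← pow_add, Nat.mod_add_div]
  rw [h2, mul_apply_eq_comp]
  -- Rounding `n` down to a multiple of `p` costs at most the factor `r ^ p = 1 / 2`; this is the 2
  -- in the constant `2 * M`.
  have h3 : (1 / 2 : ℝ) ^ (n / p) ≤ 2 * r ^ n := by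
    have h4 : r ^ n = r ^ (n % p) * (1 / 2) ^ (n / p) := by
      rw [← hrp, ← pow_mul, ← pow_add, Nat.mod_add_div]
    have h5 : 1 / 2 ≤ r ^ (n % p) := by
      rw [← hrp]
      exact pow_le_pow_of_le_one hr0.le hr1.le (Nat.mod_lt _ hp).le
    rw [h4]
    nlinarith [show (0 : ℝ) < (1 / 2) ^ (n / p) by positivity]
  calc _ ≤ M * ‖(L ^ (p * (n / p))) f‖ := hM _ _
    _ ≤ M * ((1 / 2) ^ (n / p) * ‖f‖) := by gcongr; exact h1 _
    _ ≤ M * (2 * r ^ n * ‖f‖) := by gcongr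
    _ = _ := by ring

/-- A finite `L¹` net of the zero-average unit ball has a common time `n` at which all its points
are small. As `L` does not expand `L¹`, every `L^n f` is then small in `L¹`, and `k (j + 1)` further
steps of Lasota–Yorke make it small in the strong norm. -/
theorem exists_norm_pow_le_half {k : ℕ} (hk : 1 ≤ k) {β C : ℝ} (hβ : 0 < β)
    (hβ1 : β < 1) (hC : 0 < C) (hLY : ∀ f : B, ‖(L ^ k) f‖ ≤ β * ‖f‖ + C * ‖ι f‖)
    (hcontr : ∀ f : B, ‖ι (L f)‖ ≤ ‖ι f‖) (hle : ∀ f : B, ‖ι f‖ ≤ ‖f‖)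
    (hcomp : IsCompact (closure (ι '' Metric.closedBall (0 : B) 1)))
    {M : ℝ} (hM1 : 1 ≤ M) (hM : ∀ (n : ℕ) (f : B), ‖(L ^ n) f‖ ≤ M * ‖f‖)
    (htend : ∀ f : B, average ι f = 0 → Tendsto (fun n : ℕ ↦ (L ^ n) f) atTop (𝓝 0)) :
    ∃ p : ℕ, 1 ≤ p ∧ ∀ f : B, average ι f = 0 → ‖(L ^ p) f‖ ≤ 1 / 2 * ‖f‖ := by
  have h1 : 0 < 1 - β := sub_pos.2 hβ1
  set R := C / (1 - β) with hR
  have hR0 : 0 < R := by positivity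
  set U : Set B := {f | average ι f = 0 ∧ ‖f‖ ≤ 1} with hU
  have htb : TotallyBounded (ι '' U) := by
    refine hcomp.totallyBounded.subset ((image_mono fun f hf ↦ ?_).trans subset_closure)
    simpa using hf.2
  -- This `ε`, and below `j` with `β ^ j < 1 / (4 * M)`, make each of the two final terms at most `1
  -- / 4`. Using `j + 1` instead of `j` ensures that the time is positive.
  set ε : ℝ := 1 / (8 * R) with hε
  have hε0 : 0 < ε := by positivity
  obtain ⟨t, htU, htfin, ht⟩ := Metric.finite_approx_of_totallyBounded htb ε hε0
  obtain ⟨u, huU, hufin, rfl⟩ := exists_subset_image_finite_and.1 ⟨t, htU, htfin, rfl⟩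
  have hev : ∀ᶠ n : ℕ in atTop, ∀ g ∈ u, ‖(L ^ n) g‖ < ε := by
    rw [eventually_all_finite hufin]
    intro g hg
    have := (htend g (huU hg).1).norm
    rw [norm_zero] at this
    exact this.eventually (gt_mem_nhds hε0)
  obtain ⟨n, hn⟩ := hev.exists
  obtain ⟨j, hj⟩ := exists_pow_lt_of_lt_one (show 0 < 1 / (4 * M) by positivity) hβ1
  have key : ∀ f ∈ U, ‖(L ^ (k * (j + 1) + n)) f‖ ≤ 1 / 2 := fun f hf ↦ by
    obtain ⟨g, hg, hfg⟩ : ∃ g ∈ u, dist (ι f) (ι g) < ε := by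
      simpa using ht (mem_image_of_mem ι hf)
    have h2 : ‖ι ((L ^ n) f)‖ ≤ 2 * ε := by
      have h3 : ι ((L ^ n) f) = ι ((L ^ n) (f - g)) + ι ((L ^ n) g) := by
        simp
      rw [h3]
      refine (norm_add_le _ _).trans ?_
      have h4 := norm_pow_apply_le_of_le hcontr n (f - g)
      rw [map_sub ι f g, ← dist_eq_norm] at h4
      linarith [hle ((L ^ n) g), hn g hg]
    have h5 : β ^ (j + 1) ≤ 1 / (4 * M) := by
      rw [pow_succ]
      nlinarith [pow_pos hβ j]
    rw [pow_add, mul_apply_eq_comp]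
    calc _ ≤ β ^ (j + 1) * ‖(L ^ n) f‖ + R * ‖ι ((L ^ n) f)‖ :=
          norm_pow_mul_apply_le hβ hβ1 hC hLY hcontr _ _
      _ ≤ 1 / (4 * M) * (M * 1) + R * (2 * ε) := by
          gcongr
          exact (hM n f).trans (by gcongr; exact hf.2)
      _ = 1 / 2 := by rw [hε]; field_simp; norm_num
  refine ⟨k * (j + 1) + n, ?_, fun f hf ↦ ?_⟩
  · nlinarith [Nat.zero_le n, Nat.zero_le j]
  · by_cases h0 : ‖f‖ = 0
    · simp [norm_eq_zero.1 h0]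
    · have h6 := key (‖f‖⁻¹ • f) ⟨by rw [map_smul, hf, smul_zero], by
        rw [norm_smul, norm_inv, norm_norm, inv_mul_cancel₀ h0]⟩
      rw [map_smul, norm_smul, norm_inv, norm_norm, inv_mul_le_iff₀ (by positivity)] at h6
      linarith

/-- On the functions of zero average, an operator which satisfies a Lasota–Yorke inequality with
respect to a compact embedding in `L¹` and which attracts all densities to one of them contracts
exponentially. -/
theorem exists_zeroAverageDecay (hι : Function.Injective ι) (hle : ∀ f : B, ‖ι f‖ ≤ ‖f‖)
    (hcontr : ∀ f : B, ‖ι (L f)‖ ≤ ‖ι f‖) (hint : ∀ f : B, average ι (L f) = average ι f)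
    (hcomp : IsCompact (closure (ι '' Metric.closedBall (0 : B) 1)))
    {k : ℕ} (hk : 1 ≤ k) {β C : ℝ} (hβ : 0 < β) (hβ1 : β < 1) (hC : 0 < C)
    (hLY : ∀ f : B, ‖(L ^ k) f‖ ≤ β * ‖f‖ + C * ‖ι f‖) {ψ₀ : B} (hLψ : L ψ₀ = ψ₀)
    (hconv : ∀ ψ : B, IsDensity ι ψ → Tendsto (fun n : ℕ ↦ (L ^ n) (ψ₀ - ψ)) atTop (𝓝 0))
    (hS : Dense (Submodule.span ℝ {f : B | 0 ≤ ι f} : Set B)) :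
    ∃ r D : ℝ, ZeroAverageDecay ι L r D := by
  obtain ⟨M, hM1, hM⟩ := exists_norm_pow_apply_le hk hβ hβ1 hC hLY hcontr hle
  obtain ⟨p, hp, hhalf⟩ := exists_norm_pow_le_half hk hβ hβ1 hC hLY hcontr hle hcomp hM1 hM
    fun f hf ↦ tendsto_pow_apply_of_average_eq_zero hι hle hM hLψ hconv hS hf
  exact norm_pow_apply_le_geometric hM1 hM hint hp hhalf

end StrongSpace

/-! ### Integration against a signed measure -/

section Pairing

variable {Z W : Type*} [MeasurableSpace Z] [MeasurableSpace W]

/-- The integral of a function against a signed measure. -/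
def pairing (s : SignedMeasure Z) (g : Z → ℝ) : ℝ :=
  ∫ z, g z ∂s.toJordanDecomposition.posPart - ∫ z, g z ∂s.toJordanDecomposition.negPart

theorem integrable_of_abs_le {μ : Measure Z} [IsFiniteMeasure μ] {g : Z → ℝ} (hg : Measurable g)
    {c : ℝ} (hc : ∀ z, |g z| ≤ c) : Integrable g μ :=
  Integrable.of_bound hg.aestronglyMeasurable c (Eventually.of_forall hc)

theorem eq_posPart_sub_negPart (s : SignedMeasure Z) :
    s = s.toJordanDecomposition.posPart.toSignedMeasure -
      s.toJordanDecomposition.negPart.toSignedMeasure :=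
  s.toSignedMeasure_toJordanDecomposition.symm

/-- Sums and images of Jordan decompositions need not be Jordan decompositions, so the pairing must
be computable from any difference of finite measures. Two such differences agree after adding
crosswise, an identity of positive measures. -/
theorem pairing_toSignedMeasure_sub (μ ν : Measure Z) [IsFiniteMeasure μ] [IsFiniteMeasure ν]
    {g : Z → ℝ} (hg : Measurable g) {c : ℝ} (hc : ∀ z, |g z| ≤ c) :
    pairing (μ.toSignedMeasure - ν.toSignedMeasure) g = ∫ z, g z ∂μ - ∫ z, g z ∂ν := by
  set s := μ.toSignedMeasure - ν.toSignedMeasure with hs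
  have h1 := eq_posPart_sub_negPart s
  have h2 : s.toJordanDecomposition.posPart + ν = μ + s.toJordanDecomposition.negPart := by
    rw [← Measure.toSignedMeasure_eq_toSignedMeasure_iff, Measure.toSignedMeasure_add,
      Measure.toSignedMeasure_add]
    rw [hs] at h1
    rw [← sub_eq_sub_iff_add_eq_add]
    exact h1.symm
  have h3 := congrArg (fun ρ : Measure Z ↦ ∫ z, g z ∂ρ) h2
  rw [integral_add_measure (integrable_of_abs_le hg hc) (integrable_of_abs_le hg hc),
    integral_add_measure (integrable_of_abs_le hg hc) (integrable_of_abs_le hg hc)] at h3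
  unfold pairing
  linarith

theorem pairing_map (s : SignedMeasure Z) {f : Z → W} (hf : Measurable f) {g : W → ℝ}
    (hg : Measurable g) {c : ℝ} (hc : ∀ w, |g w| ≤ c) :
    pairing (s.map f) g = pairing s (g ∘ f) := by
  have h1 : s.map f = (s.toJordanDecomposition.posPart.map f).toSignedMeasure -
      (s.toJordanDecomposition.negPart.map f).toSignedMeasure := by
    ext A hA
    rw [VectorMeasure.map_apply _ hf hA, s.apply_eq_posPart_real_sub_negPart_real (hf hA),
      sub_apply, Measure.toSignedMeasure_apply_measurable hA,
      Measure.toSignedMeasure_apply_measurable hA, map_measureReal_apply hf hA,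
      map_measureReal_apply hf hA]
  rw [h1, pairing_toSignedMeasure_sub _ _ hg hc, integral_map hf.aemeasurable
    hg.aestronglyMeasurable, integral_map hf.aemeasurable hg.aestronglyMeasurable]
  rfl

theorem pairing_add_measure (s t : SignedMeasure Z) {g : Z → ℝ} (hg : Measurable g) {c : ℝ}
    (hc : ∀ z, |g z| ≤ c) : pairing (s + t) g = pairing s g + pairing t g := by
  have h1 : s + t = (s.toJordanDecomposition.posPart +
      t.toJordanDecomposition.posPart).toSignedMeasure -
      (s.toJordanDecomposition.negPart + t.toJordanDecomposition.negPart).toSignedMeasure := by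
    rw [Measure.toSignedMeasure_add, Measure.toSignedMeasure_add]
    conv_lhs => rw [eq_posPart_sub_negPart s, eq_posPart_sub_negPart t]
    abel
  rw [h1, pairing_toSignedMeasure_sub _ _ hg hc, integral_add_measure (integrable_of_abs_le hg hc)
    (integrable_of_abs_le hg hc), integral_add_measure (integrable_of_abs_le hg hc)
    (integrable_of_abs_le hg hc)]
  unfold pairing
  ring

theorem pairing_smul_measure (r : ℝ) (s : SignedMeasure Z) (g : Z → ℝ) :
    pairing (r • s) g = r * pairing s g := by
  unfold pairing
  rw [SignedMeasure.toJordanDecomposition_smul_real]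
  rcases le_or_gt 0 r with hr | hr
  · rw [JordanDecomposition.real_smul_posPart_nonneg _ _ hr,
      JordanDecomposition.real_smul_negPart_nonneg _ _ hr, integral_smul_nnreal_measure,
      integral_smul_nnreal_measure]
    simp only [NNReal.smul_def, Real.coe_toNNReal r hr, smul_eq_mul]
    ring
  · rw [JordanDecomposition.real_smul_posPart_neg _ _ hr,
      JordanDecomposition.real_smul_negPart_neg _ _ hr, integral_smul_nnreal_measure,
      integral_smul_nnreal_measure]
    simp only [NNReal.smul_def, Real.coe_toNNReal (-r) (by linarith), smul_eq_mul]
    ring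

theorem pairing_add (s : SignedMeasure Z) {g h : Z → ℝ} (hg : Measurable g) {c : ℝ}
    (hc : ∀ z, |g z| ≤ c) (hh : Measurable h) {d : ℝ} (hd : ∀ z, |h z| ≤ d) :
    pairing s (g + h) = pairing s g + pairing s h := by
  unfold pairing
  simp only [Pi.add_apply]
  rw [integral_add (integrable_of_abs_le hg hc) (integrable_of_abs_le hh hd),
    integral_add (integrable_of_abs_le hg hc) (integrable_of_abs_le hh hd)]
  ring

theorem pairing_smul (s : SignedMeasure Z) (r : ℝ) (g : Z → ℝ) :
    pairing s (r • g) = r * pairing s g := by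
  unfold pairing
  simp only [Pi.smul_apply, smul_eq_mul]
  rw [integral_const_mul, integral_const_mul, mul_sub]

end Pairing

/-! ### Pairing with functions of the base variable -/

section Marginal

variable {X Y : Type*} [MeasurableSpace X] [MeasurableSpace Y] {m : Measure X} [SigmaFinite m]

theorem pairing_comp_fst {s : SignedMeasure (X × Y)} (hs : HasACMarginals m s) {c : X → ℝ}
    (hc : Measurable c) {d : ℝ} (hd : ∀ x, |c x| ≤ d) :
    pairing s (fun p ↦ c p.1) = ∫ x, marginalDensity m s x * c x ∂m := by
  have h : ∀ μ : Measure (X × Y), IsFiniteMeasure μ → μ.fst ≪ m →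
      Integrable (fun x ↦ (μ.fst.rnDeriv m x).toReal * c x) m ∧
      ∫ p, c p.1 ∂μ = ∫ x, (μ.fst.rnDeriv m x).toReal * c x ∂m := fun μ _ hμ ↦ by
    refine ⟨(integrable_rnDeriv_smul_iff hμ).2 (integrable_of_abs_le hc hd), ?_⟩
    have h1 := integral_rnDeriv_smul (f := c) hμ
    simp only [smul_eq_mul] at h1
    rw [h1, Measure.fst, integral_map measurable_fst.aemeasurable hc.aestronglyMeasurable]
  obtain ⟨i1, e1⟩ := h _ inferInstance hs.1
  obtain ⟨i2, e2⟩ := h _ inferInstance hs.2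
  unfold pairing marginalDensity
  rw [e1, e2, ← integral_sub i1 i2]
  congr with x
  ring

theorem abs_pairing_comp_fst_le {s : SignedMeasure (X × Y)} (hs : HasACMarginals m s) {c : X → ℝ}
    (hc : Measurable c) (hd : ∀ x, |c x| ≤ 1) :
    |pairing s (fun p ↦ c p.1)| ≤ ∫ x, |marginalDensity m s x| ∂m := by
  rw [pairing_comp_fst hs hc hd]
  refine (abs_integral_le_integral_abs).trans ?_
  refine integral_mono_of_nonneg (Eventually.of_forall fun x ↦ abs_nonneg _)
    (integrable_marginalDensity s).abs (Eventually.of_forall fun x ↦ ?_)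
  simp only [abs_mul]
  exact mul_le_of_le_one_right (abs_nonneg _) (hd x)

end Marginal

/-! ### Duality for the weak norm -/

section Duality

/-- A measurable function on `X × Y`, bounded by one and with Lipschitz constant at most one along
each fibre. -/
structure IsTestFunction {X Y : Type*} [MeasurableSpace X] [PseudoMetricSpace Y]
    [MeasurableSpace Y] (g : X × Y → ℝ) : Prop where
  measurable : Measurable g
  lipschitz : ∀ x, LipschitzWith 1 fun y ↦ g (x, y)
  abs_le_one : ∀ p, |g p| ≤ 1

variable (Y : Type*) [MetricSpace Y]

/-- The functions on `Y` with Lipschitz constant and sup norm at most one. -/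
abbrev LipUnitBall : Type _ := {f : C(Y, ℝ) // LipschitzWith 1 f ∧ ∀ y, |f y| ≤ 1}

instance : Nonempty (LipUnitBall Y) := ⟨⟨0, LipschitzWith.const' 0, by simp⟩⟩

variable {Y} [CompactSpace Y] [MeasurableSpace Y] [BorelSpace Y]

theorem continuous_integral_continuousMap (μ : Measure Y) [IsFiniteMeasure μ] :
    Continuous fun f : C(Y, ℝ) ↦ ∫ y, f y ∂μ := by
  refine LipschitzWith.continuous (K := (μ univ).toNNReal) (LipschitzWith.of_dist_le_mul ?_)
  intro f g
  have hi : ∀ f : C(Y, ℝ), Integrable f μ := fun f ↦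
    f.continuous.integrable_of_hasCompactSupport (HasCompactSupport.of_compactSpace f)
  rw [dist_eq_norm, ← integral_sub (hi f) (hi g), mul_comm]
  refine norm_integral_le_of_norm_le_const (Eventually.of_forall fun y ↦ ?_)
  rw [← dist_eq_norm]
  exact ContinuousMap.dist_apply_le_dist y

/-- Separability of the Lipschitz unit ball in the sup norm reduces the supremum to a countable one,
within reach of monotone convergence over the base. -/
theorem wDist_eq_iSup_denseSeq (μ ν : Measure Y) [IsFiniteMeasure μ] [IsFiniteMeasure ν] :
    wDist μ ν = ⨆ n, ENNReal.ofReal |∫ y, (TopologicalSpace.denseSeq (LipUnitBall Y) n).1 y ∂μ -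
      ∫ y, (TopologicalSpace.denseSeq (LipUnitBall Y) n).1 y ∂ν| := by
  apply le_antisymm
  · refine iSup_le fun g ↦ ?_
    let f : LipUnitBall Y := ⟨⟨g.1, g.2.1.continuous⟩, g.2⟩
    change ENNReal.ofReal |∫ y, f.1 y ∂μ - ∫ y, f.1 y ∂ν| ≤ _
    refine (TopologicalSpace.denseRange_denseSeq (LipUnitBall Y)).induction_on f
      (isClosed_le ?_ continuous_const) fun n ↦ le_iSup (fun n ↦ ENNReal.ofReal
        |∫ y, (TopologicalSpace.denseSeq (LipUnitBall Y) n).1 y ∂μ -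
        ∫ y, (TopologicalSpace.denseSeq (LipUnitBall Y) n).1 y ∂ν|) n
    exact ENNReal.continuous_ofReal.comp (((continuous_integral_continuousMap μ).comp
      continuous_subtype_val).sub ((continuous_integral_continuousMap ν).comp
      continuous_subtype_val)).abs
  · refine iSup_le fun n ↦ ?_
    exact le_iSup (fun g : {g : Y → ℝ // LipschitzWith 1 g ∧ ∀ y, |g y| ≤ 1} ↦
      ENNReal.ofReal |∫ y, g.1 y ∂μ - ∫ y, g.1 y ∂ν|)
      ⟨_, (TopologicalSpace.denseSeq (LipUnitBall Y) n).2⟩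

variable {X : Type*} [MeasurableSpace X] [Nonempty Y] {m : Measure X} [SigmaFinite m]

variable (m) in
/-- The integral of `g` over the leaf through `x` against the restriction to the leaf of a signed
measure. -/
def leafPairing (s : SignedMeasure (X × Y)) (g : X × Y → ℝ) (x : X) : ℝ :=
  ∫ y, g (x, y) ∂leafRestriction m s.toJordanDecomposition.posPart x -
    ∫ y, g (x, y) ∂leafRestriction m s.toJordanDecomposition.negPart x

omit [SigmaFinite m] in
theorem integral_leafRestriction (μ : Measure (X × Y)) [IsFiniteMeasure μ] (g : X × Y → ℝ) (x : X) :
    ∫ y, g (x, y) ∂leafRestriction m μ x =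
      (μ.fst.rnDeriv m x).toReal • ∫ y, g (x, y) ∂μ.condKernel x := by
  rw [leafRestriction, integral_smul_measure]

omit [SigmaFinite m] in
theorem measurable_integral_leafRestriction (μ : Measure (X × Y)) [IsFiniteMeasure μ]
    {g : X × Y → ℝ} (hg : Measurable g) :
    Measurable fun x ↦ ∫ y, g (x, y) ∂leafRestriction m μ x := by
  simp_rw [integral_leafRestriction]
  exact (Measure.measurable_rnDeriv _ _).ennreal_toReal.smul
    hg.stronglyMeasurable.integral_kernel_prod_right'.measurable

theorem integrable_integral_leafRestriction {μ : Measure (X × Y)} [IsFiniteMeasure μ]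
    (hμ : μ.fst ≪ m) {g : X × Y → ℝ} (hg : Measurable g) {c : ℝ} (hc : ∀ p, |g p| ≤ c) :
    Integrable (fun x ↦ ∫ y, g (x, y) ∂leafRestriction m μ x) m := by
  simp_rw [integral_leafRestriction]
  exact (integrable_rnDeriv_smul_iff hμ).2 (integrable_of_abs_le hg hc).integral_condKernel

theorem integral_integral_leafRestriction {μ : Measure (X × Y)} [IsFiniteMeasure μ]
    (hμ : μ.fst ≪ m) {g : X × Y → ℝ} (hg : Measurable g) {c : ℝ} (hc : ∀ p, |g p| ≤ c) :
    ∫ x, ∫ y, g (x, y) ∂leafRestriction m μ x ∂m = ∫ p, g p ∂μ := by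
  simp_rw [integral_leafRestriction]
  rw [integral_rnDeriv_smul hμ, Measure.integral_condKernel]
  exact integrable_of_abs_le hg hc

theorem measurable_leafPairing (s : SignedMeasure (X × Y)) {g : X × Y → ℝ} (hg : Measurable g) :
    Measurable (leafPairing m s g) :=
  (measurable_integral_leafRestriction _ hg).sub (measurable_integral_leafRestriction _ hg)

theorem integrable_leafPairing {s : SignedMeasure (X × Y)} (hs : HasACMarginals m s)
    {g : X × Y → ℝ} (hg : Measurable g) {c : ℝ} (hc : ∀ p, |g p| ≤ c) :
    Integrable (leafPairing m s g) m :=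
  (integrable_integral_leafRestriction hs.1 hg hc).sub
    (integrable_integral_leafRestriction hs.2 hg hc)

theorem integral_leafPairing {s : SignedMeasure (X × Y)} (hs : HasACMarginals m s)
    {g : X × Y → ℝ} (hg : Measurable g) {c : ℝ} (hc : ∀ p, |g p| ≤ c) :
    ∫ x, leafPairing m s g x ∂m = pairing s g := by
  unfold leafPairing pairing
  rw [integral_sub (integrable_integral_leafRestriction hs.1 hg hc)
    (integrable_integral_leafRestriction hs.2 hg hc),
    integral_integral_leafRestriction hs.1 hg hc, integral_integral_leafRestriction hs.2 hg hc]

/-- The easy half of the duality: on every leaf, `g (x, ·)` competes in the supremum defining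
`wDist`. -/
theorem pairing_le_weakNorm {s : SignedMeasure (X × Y)} (hs : HasACMarginals m s)
    {g : X × Y → ℝ} (hg : IsTestFunction g) : pairing s g ≤ (weakNorm m s).toReal := by
  rw [← integral_leafPairing hs hg.measurable hg.abs_le_one]
  refine (le_abs_self _).trans ?_
  rw [← Real.norm_eq_abs]
  refine (norm_integral_le_lintegral_norm _).trans ?_
  refine ENNReal.toReal_mono (weakNorm_lt_top m s).ne (lintegral_mono fun x ↦ ?_)
  exact le_iSup (fun g : {g : Y → ℝ // LipschitzWith 1 g ∧ ∀ y, |g y| ≤ 1} ↦ ENNReal.ofReal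
    |∫ y, g.1 y ∂leafRestriction m s.toJordanDecomposition.posPart x -
      ∫ y, g.1 y ∂leafRestriction m s.toJordanDecomposition.negPart x|)
    ⟨fun y ↦ g (x, y), hg.lipschitz x, fun y ↦ hg.abs_le_one _⟩

omit [CompactSpace Y] [Nonempty Y] in
theorem IsTestFunction.comp_snd (f : LipUnitBall Y) :
    IsTestFunction fun p : X × Y ↦ f.1 p.2 :=
  ⟨f.1.continuous.measurable.comp measurable_snd, fun _ ↦ f.2.1, fun p ↦ f.2.2 p.2⟩

omit [CompactSpace Y] [BorelSpace Y] [Nonempty Y] in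
theorem IsTestFunction.neg {g : X × Y → ℝ} (hg : IsTestFunction g) :
    IsTestFunction fun p ↦ -g p :=
  ⟨hg.measurable.neg, fun x ↦ (hg.lipschitz x).neg, fun p ↦ by rw [abs_neg]; exact hg.abs_le_one p⟩

/-- Two test functions can be combined to one which has the larger integral on each leaf. -/
theorem IsTestFunction.exists_max (m : Measure X) [SigmaFinite m] (s : SignedMeasure (X × Y))
    {g h : X × Y → ℝ} (hg : IsTestFunction g) (hh : IsTestFunction h) :
    ∃ k, IsTestFunction k ∧
      ∀ x, leafPairing m s k x = max (leafPairing m s g x) (leafPairing m s h x) := by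
  classical
  set A : Set X := {x | leafPairing m s h x ≤ leafPairing m s g x}
  have hA : MeasurableSet A := measurableSet_le (measurable_leafPairing s hh.measurable)
    (measurable_leafPairing s hg.measurable)
  refine ⟨fun p ↦ if p.1 ∈ A then g p else h p, ⟨?_, fun x ↦ ?_, fun p ↦ ?_⟩, fun x ↦ ?_⟩
  · exact Measurable.ite (measurable_fst hA) hg.measurable hh.measurable
  · by_cases hx : x ∈ A
    · simpa [hx] using hg.lipschitz x
    · simpa [hx] using hh.lipschitz x
  · split_ifs
    exacts [hg.abs_le_one p, hh.abs_le_one p]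
  · by_cases hx : x ∈ A
    · rw [max_eq_left hx]
      simp [leafPairing, hx]
    · rw [max_eq_right (not_le.1 hx).le]
      simp [leafPairing, hx]

omit [SigmaFinite m] in
theorem ae_isFiniteMeasure_leafRestriction (μ : Measure (X × Y)) [IsFiniteMeasure μ] :
    ∀ᵐ x ∂m, IsFiniteMeasure (leafRestriction m μ x) := by
  filter_upwards [Measure.rnDeriv_lt_top μ.fst m] with x hx
  refine ⟨?_⟩
  simpa [leafRestriction] using hx

/-- A measurable choice of nearly optimal functions on the leaves: start from zero, and at step `n`
keep on each leaf the best among the current function, the `n`-th function of the dense sequence and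
its negative. Taking both signs produces the absolute value. -/
theorem exists_monotone_testFunction (m : Measure X) [SigmaFinite m] (s : SignedMeasure (X × Y)) :
    ∃ h : ℕ → X × Y → ℝ, (∀ n, IsTestFunction (h n)) ∧
      (∀ n x, leafPairing m s (h n) x ≤ leafPairing m s (h (n + 1)) x) ∧
      ∀ n x, |leafPairing m s (fun p ↦ (TopologicalSpace.denseSeq (LipUnitBall Y) n).1 p.2) x| ≤
        leafPairing m s (h (n + 1)) x := by
  have step : ∀ (n : ℕ) (h : {h : X × Y → ℝ // IsTestFunction h}),
      ∃ h' : {h : X × Y → ℝ // IsTestFunction h}, ∀ x,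
        leafPairing m s h.1 x ≤ leafPairing m s h'.1 x ∧
        |leafPairing m s (fun p ↦ (TopologicalSpace.denseSeq (LipUnitBall Y) n).1 p.2) x| ≤
          leafPairing m s h'.1 x := by
    intro n h
    have hf := IsTestFunction.comp_snd (X := X) (TopologicalSpace.denseSeq (LipUnitBall Y) n)
    obtain ⟨k, hk, hk'⟩ := hf.exists_max m s hf.neg
    obtain ⟨l, hl, hl'⟩ := h.2.exists_max m s hk
    refine ⟨⟨l, hl⟩, fun x ↦ ?_⟩
    simp only [hl', hk']
    refine ⟨le_max_left _ _, le_max_of_le_right ?_⟩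
    rw [abs_eq_max_neg]
    refine max_le_max le_rfl (le_of_eq ?_)
    simp only [leafPairing, integral_neg]
    ring
  choose nxt hnxt using step
  let h : ℕ → {h : X × Y → ℝ // IsTestFunction h} := fun n ↦
    Nat.rec ⟨0, measurable_zero, fun _ ↦ LipschitzWith.const' 0, by simp⟩ (fun n h ↦ nxt n h) n
  exact ⟨fun n ↦ (h n).1, fun n ↦ (h n).2, fun n x ↦ (hnxt n (h n) x).1,
    fun n x ↦ (hnxt n (h n) x).2⟩

/-- The weak norm is the supremum of the integrals of the test functions. -/
theorem weakNorm_le {s : SignedMeasure (X × Y)} (hs : HasACMarginals m s) {c : ℝ}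
    (hc : ∀ g, IsTestFunction g → pairing s g ≤ c) : weakNorm m s ≤ ENNReal.ofReal c := by
  obtain ⟨h, htest, hmono, hle⟩ := exists_monotone_testFunction m s
  have h0 : ∀ n x, 0 ≤ leafPairing m s (h (n + 1)) x := fun n x ↦ (abs_nonneg _).trans (hle n x)
  calc weakNorm m s ≤ ∫⁻ x, ⨆ n, ENNReal.ofReal (leafPairing m s (h (n + 1)) x) ∂m := by
        -- Passing to the dense sequence requires finite leaf measures, which holds almost
        -- everywhere. Measurability of `wDist` in `x` is not needed for this inequality.
        refine lintegral_mono_ae ?_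
        filter_upwards [ae_isFiniteMeasure_leafRestriction s.toJordanDecomposition.posPart,
          ae_isFiniteMeasure_leafRestriction s.toJordanDecomposition.negPart] with x h1 h2
        rw [wDist_eq_iSup_denseSeq]
        exact iSup_mono fun n ↦ ENNReal.ofReal_le_ofReal (hle n x)
    _ = ⨆ n, ∫⁻ x, ENNReal.ofReal (leafPairing m s (h (n + 1)) x) ∂m := by
        refine lintegral_iSup
          (fun n ↦ (measurable_leafPairing s (htest _).measurable).ennreal_ofReal) ?_
        exact monotone_nat_of_le_succ fun n x ↦ ENNReal.ofReal_le_ofReal (hmono (n + 1) x)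
    _ ≤ ENNReal.ofReal c := by
        refine iSup_le fun n ↦ ?_
        rw [← ofReal_integral_eq_lintegral_ofReal
          (integrable_leafPairing hs (htest _).measurable (htest _).abs_le_one)
          (Eventually.of_forall (h0 n)),
          integral_leafPairing hs (htest _).measurable (htest _).abs_le_one]
        exact ENNReal.ofReal_le_ofReal (hc _ (htest _))

theorem toReal_weakNorm_le {s : SignedMeasure (X × Y)} (hs : HasACMarginals m s) {c : ℝ}
    (hc0 : 0 ≤ c) (hc : ∀ g, IsTestFunction g → pairing s g ≤ c) : (weakNorm m s).toReal ≤ c :=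
  ENNReal.toReal_le_of_le_ofReal hc0 (weakNorm_le hs hc)

/-- The weak norm is defined through Jordan decompositions, which are not additive; the triangle
inequality is read off the dual description, where the pairing is linear. -/
theorem toReal_weakNorm_add_smul_le {s t : SignedMeasure (X × Y)} (hs : HasACMarginals m s)
    (ht : HasACMarginals m t) (c : ℝ) :
    (weakNorm m (s + c • t)).toReal ≤ (weakNorm m s).toReal + |c| * (weakNorm m t).toReal := by
  refine toReal_weakNorm_le (hs.add (ht.smul c)) (by positivity) fun g hg ↦ ?_
  rw [pairing_add_measure _ _ hg.measurable hg.abs_le_one, pairing_smul_measure]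
  have h1 := pairing_le_weakNorm ht hg.neg
  have h2 : pairing t (fun p ↦ -g p) = -pairing t g := by
    simp only [pairing, integral_neg]; ring
  rw [h2] at h1
  have h3 : |pairing t g| ≤ (weakNorm m t).toReal :=
    abs_le.2 ⟨by linarith, pairing_le_weakNorm ht hg⟩
  refine add_le_add (pairing_le_weakNorm hs hg) ((le_abs_self _).trans ?_)
  rw [abs_mul]
  gcongr

end Duality

/-! ### The action of the skew product -/

section PerronFrobenius

variable {X : Type*} [MeasurableSpace X] {m : Measure X} [SigmaFinite m] {T : X → X}

/-- Nonsingularity makes the pushed measure absolutely continuous, so its Radon–Nikodym density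
misses no singular part. -/
theorem setIntegral_perronFrobenius (hT : Measurable T)
    (hns : ∀ A : Set X, MeasurableSet A → m A = 0 → m (T ⁻¹' A) = 0) (φ : Lp ℝ 1 m) {A : Set X}
    (hA : MeasurableSet A) :
    ∫ x in A, perronFrobenius m T φ x ∂m = ∫ x in T ⁻¹' A, φ x ∂m := by
  have hφ : Integrable φ m := L1.integrable_coeFn φ
  set ν := (m.withDensityᵥ φ).map T with hν
  have happ : ∀ A, MeasurableSet A → ν A = ∫ x in T ⁻¹' A, φ x ∂m := fun A hA ↦ by
    rw [hν, VectorMeasure.map_apply _ hT hA, withDensityᵥ_apply hφ (hT hA)]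
  have hac : ν ≪ᵥ m.toENNRealVectorMeasure := by
    refine VectorMeasure.AbsolutelyContinuous.mk fun A hA hmA ↦ ?_
    rw [Measure.toENNRealVectorMeasure_apply_measurable hA] at hmA
    rw [happ A hA, Measure.restrict_eq_zero.2 (hns A hA hmA), integral_zero_measure]
  rw [← happ A hA, ← SignedMeasure.withDensityᵥ_rnDeriv_eq ν m hac,
    withDensityᵥ_apply (SignedMeasure.integrable_rnDeriv _ _) hA]
  exact setIntegral_congr_ae hA ((Integrable.coeFn_toL1 _).mono fun x hx _ ↦ hx)

/-- Split the base by the sign of `P_T φ`: on each piece the integral of its absolute value is, up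
to sign, the integral of `φ` over the preimage. -/
theorem norm_perronFrobenius_le (hT : Measurable T)
    (hns : ∀ A : Set X, MeasurableSet A → m A = 0 → m (T ⁻¹' A) = 0) (φ : Lp ℝ 1 m) :
    ‖perronFrobenius m T φ‖ ≤ ‖φ‖ := by
  set f := perronFrobenius m T φ with hf
  have hfi : Integrable f m := L1.integrable_coeFn f
  have hφ : Integrable φ m := L1.integrable_coeFn φ
  set A : Set X := {x | 0 ≤ f x}
  have hA : MeasurableSet A := measurableSet_le measurable_const (Lp.stronglyMeasurable f).measurable
  have h1 : ∫ x in A, ‖f x‖ ∂m = ∫ x in T ⁻¹' A, φ x ∂m := by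
    rw [← setIntegral_perronFrobenius hT hns φ hA]
    exact setIntegral_congr_fun hA fun x hx ↦ Real.norm_of_nonneg hx
  have h2 : ∫ x in Aᶜ, ‖f x‖ ∂m = -∫ x in (T ⁻¹' A)ᶜ, φ x ∂m := by
    rw [← preimage_compl, ← setIntegral_perronFrobenius hT hns φ hA.compl, ← integral_neg]
    exact setIntegral_congr_fun hA.compl fun x hx ↦
      Real.norm_of_nonpos (not_le.1 (show ¬0 ≤ f x from hx)).le
  rw [L1.norm_eq_integral_norm, L1.norm_eq_integral_norm, ← integral_add_compl hA hfi.norm, h1, h2,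
    ← integral_add_compl (hT hA) hφ.norm]
  refine add_le_add ((le_abs_self _).trans ?_) ((neg_le_abs _).trans ?_)
  · exact norm_integral_le_integral_norm (φ : X → ℝ)
  · exact norm_integral_le_integral_norm (φ : X → ℝ)

theorem integral_perronFrobenius (hT : Measurable T)
    (hns : ∀ A : Set X, MeasurableSet A → m A = 0 → m (T ⁻¹' A) = 0) (φ : Lp ℝ 1 m) :
    ∫ x, perronFrobenius m T φ x ∂m = ∫ x, φ x ∂m := by
  simpa using setIntegral_perronFrobenius hT hns φ MeasurableSet.univ

variable {Y : Type*} [MeasurableSpace Y] {G : X × Y → Y}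

theorem measurable_skewProduct (hT : Measurable T) (hG : Measurable G) :
    Measurable (skewProduct T G) :=
  (hT.comp measurable_fst).prodMk hG

omit [SigmaFinite m] in
theorem HasACMarginals.map (hT : Measurable T) (hG : Measurable G)
    (hns : ∀ A : Set X, MeasurableSet A → m A = 0 → m (T ⁻¹' A) = 0)
    {s : SignedMeasure (X × Y)} (hs : HasACMarginals m s) :
    HasACMarginals m (s.map (skewProduct T G)) := by
  rw [hasACMarginals_iff] at *
  intro A hA hmA E hE hEA
  rw [VectorMeasure.map_apply _ (measurable_skewProduct hT hG) hE]
  exact hs (T ⁻¹' A) (hT hA) (hns A hA hmA) _ (measurable_skewProduct hT hG hE) fun p hp ↦ hEA hp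

theorem perronFrobenius_ae_eq (hT : Measurable T) (hG : Measurable G)
    (hns : ∀ A : Set X, MeasurableSet A → m A = 0 → m (T ⁻¹' A) = 0)
    {s : SignedMeasure (X × Y)} (hs : HasACMarginals m s) {φ : Lp ℝ 1 m}
    (hφ : φ =ᵐ[m] marginalDensity m s) :
    perronFrobenius m T φ =ᵐ[m] marginalDensity m (s.map (skewProduct T G)) := by
  refine Integrable.ae_eq_of_forall_setIntegral_eq _ _ (L1.integrable_coeFn _)
    (integrable_marginalDensity _) fun A hA _ ↦ ?_
  rw [setIntegral_perronFrobenius hT hns φ hA, setIntegral_marginalDensity (hs.map hT hG hns) hA,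
    VectorMeasure.map_apply _ (measurable_skewProduct hT hG) (measurable_fst hA),
    setIntegral_congr_ae (hT hA) (hφ.mono fun x hx _ ↦ hx),
    setIntegral_marginalDensity hs (hT hA)]
  rfl

end PerronFrobenius

/-! ### Contraction of the weak norm -/

section Contraction

variable {X Y : Type*} [MeasurableSpace X] [MetricSpace Y] [MeasurableSpace Y] [Nonempty Y]
  {T : X → X} {G : X × Y → Y}

/-- Composed with the skew product, a test function is the sum of a function of the base variable
and of a multiple of a test function. -/
theorem IsTestFunction.comp_skewProduct {g : X × Y → ℝ} (hg : IsTestFunction g)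
    (hT : Measurable T) (hG : Measurable G) (hd : ∀ y y' : Y, dist y y' ≤ 1) {α : ℝ} (hα : 0 < α)
    (hcon : ∀ x y₁ y₂, dist (G (x, y₁)) (G (x, y₂)) ≤ α * dist y₁ y₂) :
    ∃ (c : X → ℝ) (h : X × Y → ℝ), Measurable c ∧ (∀ x, |c x| ≤ 1) ∧ IsTestFunction h ∧
      g ∘ skewProduct T G = (fun p ↦ c p.1) + α • h := by
  obtain ⟨y₀⟩ := ‹Nonempty Y›
  have hF := measurable_skewProduct hT hG
  have hlip : ∀ x y y', |g (skewProduct T G (x, y)) - g (skewProduct T G (x, y'))| ≤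
      α * dist y y' := fun x y y' ↦ by
    refine le_trans ?_ (hcon x y y')
    simpa [Real.dist_eq, skewProduct] using
      (hg.lipschitz (T x)).dist_le_mul (G (x, y)) (G (x, y'))
  set c : X → ℝ := fun x ↦ g (skewProduct T G (x, y₀)) with hc
  have hcm : Measurable c := hg.measurable.comp (hF.comp measurable_prodMk_right)
  -- Here `c` is the value over the reference point `y₀`. The remainder is `α`-Lipschitz along
  -- fibres and, as distances are at most one, bounded by `α`; dividing by `α` gives a test
  -- function.
  refine ⟨c, fun p ↦ α⁻¹ * (g (skewProduct T G p) - c p.1), hcm, fun x ↦ hg.abs_le_one _,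
    ⟨?_, fun x ↦ ?_, fun p ↦ ?_⟩, ?_⟩
  · exact ((hg.measurable.comp hF).sub (hcm.comp measurable_fst)).const_mul _
  · refine LipschitzWith.of_dist_le_mul fun y y' ↦ ?_
    rw [Real.dist_eq, ← mul_sub, sub_sub_sub_cancel_right, abs_mul, abs_of_pos (inv_pos.2 hα),
      NNReal.coe_one, one_mul, inv_mul_le_iff₀ hα]
    exact hlip x y y'
  · rw [abs_mul, abs_of_pos (inv_pos.2 hα), inv_mul_le_iff₀ hα]
    exact (hlip p.1 p.2 y₀).trans (by gcongr; exact hd _ _)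
  · ext p
    simp only [Function.comp_apply, Pi.add_apply, Pi.smul_apply, smul_eq_mul]
    rw [mul_inv_cancel_left₀ hα.ne']
    ring

omit [Nonempty Y] in
theorem IsTestFunction.comp_skewProduct_of_le_one {g : X × Y → ℝ} (hg : IsTestFunction g)
    (hT : Measurable T) (hG : Measurable G) {α : ℝ} (hα : α ≤ 1)
    (hcon : ∀ x y₁ y₂, dist (G (x, y₁)) (G (x, y₂)) ≤ α * dist y₁ y₂) :
    IsTestFunction (g ∘ skewProduct T G) := by
  refine ⟨hg.measurable.comp (measurable_skewProduct hT hG), fun x ↦ ?_, fun p ↦ hg.abs_le_one _⟩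
  refine (mul_one (1 : NNReal)) ▸ (hg.lipschitz (T x)).comp
    (LipschitzWith.of_dist_le_mul fun y y' ↦ (hcon x y y').trans ?_)
  rw [NNReal.coe_one]
  gcongr

/-- The transfer operator contracts the weak norm, up to the `L¹` norm of the marginal. -/
theorem toReal_weakNorm_map_le [CompactSpace Y] [BorelSpace Y] {m : Measure X} [SigmaFinite m]
    (hT : Measurable T) (hG : Measurable G)
    (hns : ∀ A : Set X, MeasurableSet A → m A = 0 → m (T ⁻¹' A) = 0)
    (hd : ∀ y y' : Y, dist y y' ≤ 1) {α : ℝ} (hα : 0 < α)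
    (hcon : ∀ x y₁ y₂, dist (G (x, y₁)) (G (x, y₂)) ≤ α * dist y₁ y₂)
    {s : SignedMeasure (X × Y)} (hs : HasACMarginals m s) :
    (weakNorm m (s.map (skewProduct T G))).toReal ≤
      α * (weakNorm m s).toReal + ∫ x, |marginalDensity m s x| ∂m := by
  have h0 : 0 ≤ ∫ x, |marginalDensity m s x| ∂m := integral_nonneg fun _ ↦ abs_nonneg _
  refine toReal_weakNorm_le (hs.map hT hG hns) (by positivity) fun g hg ↦ ?_
  rw [pairing_map _ (measurable_skewProduct hT hG) hg.measurable hg.abs_le_one]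
  obtain ⟨c, h, hc, hc1, hh, heq⟩ := hg.comp_skewProduct hT hG hd hα hcon
  have hb : ∀ p, |(α • h) p| ≤ α := fun p ↦ by
    rw [Pi.smul_apply, smul_eq_mul, abs_mul, abs_of_pos hα]
    exact mul_le_of_le_one_right hα.le (hh.abs_le_one p)
  rw [heq, pairing_add s (g := fun p ↦ c p.1) (hc.comp measurable_fst) (fun p ↦ hc1 p.1)
    (hh.measurable.const_smul α) hb, pairing_smul, add_comm]
  exact add_le_add (mul_le_mul_of_nonneg_left (pairing_le_weakNorm hs hh) hα.le)
    ((le_abs_self _).trans (abs_pairing_comp_fst_le hs hc hc1))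

end Contraction

/-! ### The invariant measure -/

section LipschitzFunctions

variable {Y : Type*} [MetricSpace Y] [CompactSpace Y] [MeasurableSpace Y] [BorelSpace Y]

omit [CompactSpace Y] in
/-- The measure of a closed set is a limit of multiples of integrals of functions of the unit
ball of the Lipschitz functions. -/
theorem exists_tendsto_measureReal {K : Set Y} (hK : IsClosed K) :
    ∃ f : ℕ → LipUnitBall Y, ∀ μ : Measure Y, IsFiniteMeasure μ →
      Tendsto (fun n : ℕ ↦ ((n : ℝ) + 1) * ∫ y, (f n).1 y ∂μ) atTop (𝓝 (μ.real K)) := by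
  have hpos : ∀ n : ℕ, (0 : ℝ) < 1 / ((n : ℝ) + 1) := fun n ↦ by positivity
  have hle : ∀ n : ℕ, (1 : ℝ) / ((n : ℝ) + 1) ≤ 1 := fun n ↦ by
    rw [div_le_one (by positivity)]; linarith [Nat.cast_nonneg (α := ℝ) n]
  -- Thickened indicators of width `1 / (n + 1)` are `(n + 1)`-Lipschitz, so they enter the unit
  -- ball after division by `n + 1`.
  let t : ℕ → Y → ℝ := fun n y ↦ (thickenedIndicator (hpos n) K y : ℝ)
  have ht1 : ∀ n y, t n y ≤ 1 := fun n y ↦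
    NNReal.coe_le_one.2 (thickenedIndicator_le_one (hpos n) K y)
  have hlip : ∀ n : ℕ, LipschitzWith 1 fun y ↦ 1 / ((n : ℝ) + 1) * t n y := fun n ↦ by
    refine LipschitzWith.of_dist_le_mul fun y y' ↦ ?_
    have h1 := (lipschitzWith_thickenedIndicator (hpos n) K).dist_le_mul y y'
    rw [NNReal.dist_eq, NNReal.coe_inv, Real.coe_toNNReal _ (hpos n).le] at h1
    rw [Real.dist_eq, ← mul_sub, abs_mul, abs_of_pos (hpos n), NNReal.coe_one, one_mul]
    calc _ ≤ 1 / ((n : ℝ) + 1) * ((1 / ((n : ℝ) + 1))⁻¹ * dist y y') := by gcongr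
      _ = dist y y' := mul_inv_cancel_left₀ (hpos n).ne' _
  refine ⟨fun n ↦ ⟨⟨fun y ↦ 1 / ((n : ℝ) + 1) * t n y, (hlip n).continuous⟩, hlip n, fun y ↦ ?_⟩,
    fun μ _ ↦ ?_⟩
  · have h0 : 0 ≤ t n y := NNReal.coe_nonneg _
    rw [ContinuousMap.coe_mk, abs_of_nonneg (by positivity)]
    exact mul_le_one₀ (hle n) h0 (ht1 n y)
  · have h := tendsto_integral_thickenedIndicator_of_isClosed μ hK hpos
      tendsto_one_div_add_atTop_nhds_zero_nat
    refine h.congr fun n ↦ ?_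
    simp only [ContinuousMap.coe_mk]
    rw [integral_const_mul, ← mul_assoc, mul_one_div_cancel (by positivity), one_mul]

omit [CompactSpace Y] in
theorem ext_of_forall_integral_lipUnitBall {μ ν : Measure Y} [IsFiniteMeasure μ]
    [IsFiniteMeasure ν] (h : ∀ f : LipUnitBall Y, ∫ y, f.1 y ∂μ = ∫ y, f.1 y ∂ν) : μ = ν := by
  have key : ∀ K : Set Y, IsClosed K → μ K = ν K := fun K hK ↦ by
    obtain ⟨f, hf⟩ := exists_tendsto_measureReal hK
    have h1 := hf μ inferInstance
    simp_rw [h] at h1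
    have h2 := tendsto_nhds_unique h1 (hf ν inferInstance)
    rwa [measureReal_def, measureReal_def, ENNReal.toReal_eq_toReal_iff' (measure_ne_top _ _)
      (measure_ne_top _ _)] at h2
  refine ext_of_generate_finite _ ?_ isPiSystem_isClosed (fun K hK ↦ key K hK) (key _ isClosed_univ)
  rw [‹BorelSpace Y›.measurable_eq]
  exact borel_eq_generateFrom_isClosed

omit [CompactSpace Y] in
theorem measurable_of_forall_integral_lipUnitBall {X : Type*} [MeasurableSpace X]
    {κ : X → Measure Y} (hκ : ∀ x, IsProbabilityMeasure (κ x))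
    (h : ∀ f : LipUnitBall Y, Measurable fun x ↦ ∫ y, f.1 y ∂κ x) : Measurable κ := by
  refine Measurable.measure_of_isPiSystem_of_isProbabilityMeasure
    (S := {K : Set Y | IsClosed K}) ?_ isPiSystem_isClosed fun K hK ↦ ?_
  · rw [‹BorelSpace Y›.measurable_eq]
    exact borel_eq_generateFrom_isClosed
  · obtain ⟨f, hf⟩ := exists_tendsto_measureReal (show IsClosed K from hK)
    have h1 : Measurable fun x ↦ (κ x).real K :=
      measurable_of_tendsto_metrizable (fun n ↦ (h (f n)).const_mul _)
        (tendsto_pi_nhds.2 fun x ↦ hf (κ x) inferInstance)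
    have h2 : (fun x ↦ κ x K) = fun x ↦ ENNReal.ofReal ((κ x).real K) :=
      funext fun x ↦ (ofReal_measureReal).symm
    rw [h2]
    exact h1.ennreal_ofReal

/-- A sequence of probability measures on a compact metric space for which the integrals of a dense
family of Lipschitz functions converge has a limit. -/
theorem exists_forall_tendsto_integral (ν : ℕ → Measure Y) [∀ n, IsProbabilityMeasure (ν n)]
    (h : ∀ i, ∃ l, Tendsto
      (fun n ↦ ∫ y, (TopologicalSpace.denseSeq (LipUnitBall Y) i).1 y ∂ν n) atTop (𝓝 l)) :
    ∃ κ : Measure Y, IsProbabilityMeasure κ ∧ ∀ f : LipUnitBall Y,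
      Tendsto (fun n ↦ ∫ y, f.1 y ∂ν n) atTop (𝓝 (∫ y, f.1 y ∂κ)) := by
  choose l hl using h
  let P : ℕ → ProbabilityMeasure Y := fun n ↦ ⟨ν n, inferInstance⟩
  -- Compactness of the space of probability measures gives a weak limit along each ultrafilter. For
  -- ultrafilters finer than `atTop` these limits agree on the dense sequence, hence on the whole
  -- Lipschitz ball, so any one of them is the limit.
  have hlim : ∀ U : Ultrafilter ℕ, ∃ κ : ProbabilityMeasure Y, ∀ f : LipUnitBall Y,
      Tendsto (fun n ↦ ∫ y, f.1 y ∂ν n) U (𝓝 (∫ y, f.1 y ∂(κ : Measure Y))) := fun U ↦ by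
    obtain ⟨κ, -, hκ⟩ := isCompact_univ.ultrafilter_le_nhds (U.map P) (by simp)
    refine ⟨κ, fun f ↦ ?_⟩
    exact ProbabilityMeasure.tendsto_iff_forall_integral_tendsto.1
      (show Tendsto P U (𝓝 κ) from hκ) (BoundedContinuousFunction.mkOfCompact f.1)
  have hdense : ∀ (U : Ultrafilter ℕ) (κ : ProbabilityMeasure Y), (U : Filter ℕ) ≤ atTop →
      (∀ f : LipUnitBall Y, Tendsto (fun n ↦ ∫ y, f.1 y ∂ν n) U
        (𝓝 (∫ y, f.1 y ∂(κ : Measure Y)))) →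
      ∀ i, ∫ y, (TopologicalSpace.denseSeq (LipUnitBall Y) i).1 y ∂(κ : Measure Y) = l i :=
    fun U κ hU hκ i ↦ tendsto_nhds_unique (hκ _) ((hl i).mono_left hU)
  obtain ⟨κ, hκ⟩ := hlim (Ultrafilter.of atTop)
  refine ⟨κ, inferInstance, fun f ↦ (tendsto_iff_ultrafilter _ _ _).2 fun U hU ↦ ?_⟩
  obtain ⟨κ', hκ'⟩ := hlim U
  have heq : (fun f : LipUnitBall Y ↦ ∫ y, f.1 y ∂(κ : Measure Y)) =
      fun f ↦ ∫ y, f.1 y ∂(κ' : Measure Y) :=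
    (TopologicalSpace.denseRange_denseSeq (LipUnitBall Y)).equalizer
      ((continuous_integral_continuousMap _).comp continuous_subtype_val)
      ((continuous_integral_continuousMap _).comp continuous_subtype_val)
      (funext fun i ↦ (hdense _ κ (Ultrafilter.of_le _) hκ i).trans (hdense U κ' hU hκ' i).symm)
  exact (congrFun heq f) ▸ hκ' f

end LipschitzFunctions

/-! ### Lifting an invariant measure of the base -/

section InvariantMeasure

variable {X Y : Type*} [MeasurableSpace X] [MetricSpace Y] [MeasurableSpace Y]

/-- Used with `ε = 0` to localize over `A`, and with `ε = -1` to choose a sign depending on the base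
point. -/
theorem IsTestFunction.ite_comp_snd [BorelSpace Y] {A : Set X} (hA : MeasurableSet A)
    [DecidablePred (· ∈ A)] (f : LipUnitBall Y) (ε : ℝ) (hε : |ε| ≤ 1) :
    IsTestFunction fun p : X × Y ↦ (if p.1 ∈ A then 1 else ε) * f.1 p.2 := by
  have hle : ∀ x, |if x ∈ A then 1 else ε| ≤ 1 := fun x ↦ by
    split_ifs
    exacts [by simp, hε]
  refine ⟨(Measurable.ite (measurable_fst hA) measurable_const measurable_const).mul
    (f.1.continuous.measurable.comp measurable_snd), fun x ↦ ?_, fun p ↦ ?_⟩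
  · refine LipschitzWith.of_dist_le_mul fun y y' ↦ ?_
    rw [Real.dist_eq, ← mul_sub, abs_mul]
    exact (mul_le_of_le_one_left (abs_nonneg _) (hle x)).trans (f.2.1.dist_le_mul y y')
  · rw [abs_mul]
    exact mul_le_one₀ (hle _) (abs_nonneg _) (f.2.2 _)

variable [CompactSpace Y] [BorelSpace Y]

/-- The products `1_A(x) f(y)` are test functions; they determine the projection to `Y` of the
restriction to each strip, hence the mass of every rectangle. -/
theorem ext_of_forall_integral_testFunction {μ ν : Measure (X × Y)} [IsFiniteMeasure μ]
    [IsFiniteMeasure ν] (h : ∀ g, IsTestFunction g → ∫ p, g p ∂μ = ∫ p, g p ∂ν) : μ = ν := by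
  classical
  refine Measure.ext_prod fun {A B} hA hB ↦ ?_
  have key : (μ.restrict (Prod.fst ⁻¹' A)).map Prod.snd =
      (ν.restrict (Prod.fst ⁻¹' A)).map Prod.snd := by
    refine ext_of_forall_integral_lipUnitBall fun f ↦ ?_
    have h1 : ∀ ρ : Measure (X × Y), ∫ y, f.1 y ∂(ρ.restrict (Prod.fst ⁻¹' A)).map Prod.snd =
        ∫ p, (if p.1 ∈ A then 1 else 0) * f.1 p.2 ∂ρ := fun ρ ↦ by
      rw [integral_map measurable_snd.aemeasurable f.1.continuous.measurable.aestronglyMeasurable,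
        ← integral_indicator (measurable_fst hA)]
      congr with p
      by_cases hp : p.1 ∈ A <;> simp [hp, indicator]
    rw [h1, h1]
    exact h _ (IsTestFunction.ite_comp_snd hA f 0 (by simp))
  have h2 := congrArg (fun ρ : Measure Y ↦ ρ B) key
  simp only [Measure.map_apply measurable_snd hB,
    Measure.restrict_apply (measurable_snd hB)] at h2
  simpa only [Set.prod_eq, inter_comm] using h2

variable [Nonempty Y] {T : X → X} {G : X × Y → Y} {ρ : Measure X}

theorem integral_eq_integral_integral_condKernel {μ : Measure (X × Y)} [IsFiniteMeasure μ]
    {g : X × Y → ℝ} (hg : IsTestFunction g) :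
    ∫ p, g p ∂μ = ∫ x, ∫ y, g (x, y) ∂μ.condKernel x ∂μ.fst :=
  (Measure.integral_condKernel (integrable_of_abs_le hg.measurable hg.abs_le_one)).symm

/-- If two measures with the same marginal are close on the test functions, then so are the
integrals along the fibres of a Lipschitz function, in mean. -/
theorem integral_abs_sub_condKernel_le {μ ν : Measure (X × Y)} [IsFiniteMeasure μ]
    [IsFiniteMeasure ν] (hμ : μ.fst = ρ) (hν : ν.fst = ρ) {K : ℝ}
    (h : ∀ g, IsTestFunction g → |∫ p, g p ∂μ - ∫ p, g p ∂ν| ≤ K) (f : LipUnitBall Y) :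
    ∫⁻ x, ‖∫ y, f.1 y ∂μ.condKernel x - ∫ y, f.1 y ∂ν.condKernel x‖ₑ ∂ρ ≤ ENNReal.ofReal K := by
  classical
  have hf := IsTestFunction.comp_snd (X := X) f
  have hm : ∀ (μ : Measure (X × Y)) (_ : IsFiniteMeasure μ),
      Measurable fun x ↦ ∫ y, f.1 y ∂μ.condKernel x := fun μ _ ↦
    (hf.measurable.stronglyMeasurable.integral_kernel_prod_right').measurable
  have hi : ∀ (μ : Measure (X × Y)) (_ : IsFiniteMeasure μ) (g : X × Y → ℝ), IsTestFunction g →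
      Integrable (fun x ↦ ∫ y, g (x, y) ∂μ.condKernel x) μ.fst := fun μ _ g hg ↦
    (integrable_of_abs_le hg.measurable hg.abs_le_one).integral_condKernel
  -- Flipping the sign of `f` off `A` makes the difference of fibre integrals nonnegative
  -- everywhere, so one test function computes the whole `L¹` norm.
  set A : Set X := {x | ∫ y, f.1 y ∂ν.condKernel x ≤ ∫ y, f.1 y ∂μ.condKernel x}
  have hA : MeasurableSet A := measurableSet_le (hm ν inferInstance) (hm μ inferInstance)
  have hg := IsTestFunction.ite_comp_snd hA f (-1) (by simp)
  have iμ := hi μ inferInstance _ hg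
  have iν := hi ν inferInstance _ hg
  have iμf := hi μ inferInstance _ hf
  have iνf := hi ν inferInstance _ hf
  have h1 := h _ hg
  rw [integral_eq_integral_integral_condKernel hg, integral_eq_integral_integral_condKernel hg]
    at h1
  rw [hμ] at h1 iμ iμf
  rw [hν] at h1 iν iνf
  rw [← integral_sub iμ iν] at h1
  simp only [← ofReal_norm]
  have inorm : Integrable
      (fun x ↦ ‖∫ y, f.1 y ∂μ.condKernel x - ∫ y, f.1 y ∂ν.condKernel x‖) ρ :=
    (iμf.sub iνf).norm
  rw [← ofReal_integral_eq_lintegral_ofReal inorm (Eventually.of_forall fun x ↦ norm_nonneg _)]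
  refine ENNReal.ofReal_le_ofReal (le_trans (le_of_eq ?_) ((le_abs_self _).trans h1))
  congr with x
  by_cases hx : x ∈ A
  · have h2 : ∫ y, f.1 y ∂ν.condKernel x ≤ ∫ y, f.1 y ∂μ.condKernel x := hx
    simp [hx, abs_of_nonneg (sub_nonneg.2 h2)]
  · have h2 : ∫ y, f.1 y ∂μ.condKernel x < ∫ y, f.1 y ∂ν.condKernel x := not_le.1 hx
    simp [hx, integral_neg, abs_of_neg (sub_neg.2 h2)]
    ring

omit [CompactSpace Y] [BorelSpace Y] in
-- With equal marginals the base term `c` cancels, leaving a strict contraction by `α`.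
theorem abs_integral_map_sub_le (hT : Measurable T) (hG : Measurable G)
    (hd : ∀ y y' : Y, dist y y' ≤ 1) {α : ℝ} (hα : 0 < α)
    (hcon : ∀ x y₁ y₂, dist (G (x, y₁)) (G (x, y₂)) ≤ α * dist y₁ y₂)
    {μ ν : Measure (X × Y)} [IsFiniteMeasure μ] [IsFiniteMeasure ν] (hμν : μ.fst = ν.fst) {K : ℝ}
    (h : ∀ g, IsTestFunction g → |∫ p, g p ∂μ - ∫ p, g p ∂ν| ≤ K) {g : X × Y → ℝ}
    (hg : IsTestFunction g) :
    |∫ p, g p ∂μ.map (skewProduct T G) - ∫ p, g p ∂ν.map (skewProduct T G)| ≤ α * K := by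
  obtain ⟨c, k, hc, hc1, hk, heq⟩ := hg.comp_skewProduct hT hG hd hα hcon
  have h1 : ∀ μ : Measure (X × Y), IsFiniteMeasure μ → ∫ p, g p ∂μ.map (skewProduct T G) =
      ∫ x, c x ∂μ.fst + α * ∫ p, k p ∂μ := fun μ _ ↦ by
    rw [integral_map (measurable_skewProduct hT hG).aemeasurable
      hg.measurable.aestronglyMeasurable]
    have h2 : ∀ p, g (skewProduct T G p) = c p.1 + α * k p := fun p ↦ congrFun heq p
    simp_rw [h2]
    rw [integral_add (f := fun p : X × Y ↦ c p.1)
      (integrable_of_abs_le (hc.comp measurable_fst) fun p ↦ hc1 p.1)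
      ((integrable_of_abs_le hk.measurable hk.abs_le_one).const_mul α), integral_const_mul,
      Measure.fst, integral_map measurable_fst.aemeasurable hc.aestronglyMeasurable]
  rw [h1 μ inferInstance, h1 ν inferInstance, hμν, add_sub_add_left_eq_sub, ← mul_sub, abs_mul,
    abs_of_pos hα]
  gcongr
  exact h k hk

omit [MetricSpace Y] [CompactSpace Y] [BorelSpace Y] [Nonempty Y] in
theorem fst_map_skewProduct (hT : Measurable T) (hG : Measurable G) (μ : Measure (X × Y)) :
    (μ.map (skewProduct T G)).fst = μ.fst.map T := by
  rw [Measure.fst, Measure.fst, Measure.map_map measurable_fst (measurable_skewProduct hT hG),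
    Measure.map_map hT measurable_fst]
  rfl

/-- A sequence of measures with the same marginal which is exponentially Cauchy on the test
functions converges on the test functions. -/
theorem exists_tendsto_integral_testFunction [IsProbabilityMeasure ρ]
    (μ : ℕ → Measure (X × Y)) [∀ n, IsFiniteMeasure (μ n)] (hfst : ∀ n, (μ n).fst = ρ)
    {α K : ℝ} (hα0 : 0 < α) (hα1 : α < 1)
    (h : ∀ n g, IsTestFunction g → |∫ p, g p ∂μ (n + 1) - ∫ p, g p ∂μ n| ≤ α ^ n * K) :
    ∃ μ₀ : Measure (X × Y), IsProbabilityMeasure μ₀ ∧ μ₀.fst = ρ ∧ ∀ g, IsTestFunction g →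
      Tendsto (fun n ↦ ∫ p, g p ∂μ n) atTop (𝓝 (∫ p, g p ∂μ₀)) := by
  classical
  obtain ⟨y₀⟩ := id ‹Nonempty Y›
  let d : ℕ → LipUnitBall Y := TopologicalSpace.denseSeq (LipUnitBall Y)
  let I : LipUnitBall Y → ℕ → X → ℝ := fun f n x ↦ ∫ y, f.1 y ∂(μ n).condKernel x
  have hI : ∀ f n, Measurable (I f n) := fun f n ↦
    ((IsTestFunction.comp_snd (X := X) f).measurable.stronglyMeasurable.integral_kernel_prod_right'
      ).measurable
  set E : Set X := ⋂ i, {x | ∃ l, Tendsto (fun n ↦ I (d i) n x) atTop (𝓝 l)} with hE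
  have hEm : MeasurableSet E := MeasurableSet.iInter fun i ↦ measurableSet_exists_tendsto (hI (d i))
  have hEae : ∀ᵐ x ∂ρ, x ∈ E := by
    simp only [hE, mem_iInter, mem_ofPred_eq]
    rw [ae_all_iff]
    intro i
    have hm : ∀ n, AEMeasurable (fun x ↦ ‖I (d i) (n + 1) x - I (d i) n x‖ₑ) ρ := fun n ↦
      ((hI _ _).sub (hI _ _)).enorm.aemeasurable
    -- The increments have geometrically summable `L¹` norms, so for almost every `x` they are
    -- summable and the fibre integrals form a Cauchy sequence.
    have h1 : ∫⁻ x, ∑' n, ‖I (d i) (n + 1) x - I (d i) n x‖ₑ ∂ρ ≠ ⊤ := by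
      rw [lintegral_tsum hm]
      refine ne_top_of_le_ne_top ?_ (ENNReal.tsum_le_tsum fun n ↦
        integral_abs_sub_condKernel_le (hfst (n + 1)) (hfst n) (h n) (d i))
      have hs : Summable fun n ↦ α ^ n * K :=
        (summable_geometric_of_lt_one hα0.le hα1).mul_right K
      exact hs.tsum_ofReal_ne_top
    filter_upwards [ae_lt_top' (AEMeasurable.tsum hm) h1] with x hx
    refine cauchySeq_tendsto_of_complete (cauchySeq_of_summable_dist ?_)
    have h2 : Summable fun n ↦ ‖I (d i) (n + 1) x - I (d i) n x‖ :=
      summable_norm_iff.2 (Summable.of_enorm hx.ne)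
    refine h2.congr fun n ↦ ?_
    rw [dist_comm, dist_eq_norm]
  -- Off the measurable set `E` the fixed value `δ_{y₀}` is assigned, so that the limit is a
  -- measurable kernel of probability measures on the whole base.
  have hlim : ∀ x : X, ∃ κ : Measure Y, IsProbabilityMeasure κ ∧
      (x ∈ E → ∀ f, Tendsto (fun n ↦ I f n x) atTop (𝓝 (∫ y, f.1 y ∂κ))) ∧
      (x ∉ E → κ = Measure.dirac y₀) := fun x ↦ by
    by_cases hx : x ∈ E
    · obtain ⟨κ, hκ, hκ'⟩ := exists_forall_tendsto_integral (fun n ↦ (μ n).condKernel x)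
        fun i ↦ mem_iInter.1 hx i
      exact ⟨κ, hκ, fun _ ↦ hκ', fun h ↦ absurd hx h⟩
    · exact ⟨Measure.dirac y₀, inferInstance, fun h ↦ absurd h hx, fun _ ↦ rfl⟩
  choose κ hκprob hκE hκE' using hlim
  have hκm : Measurable κ := by
    refine measurable_of_forall_integral_lipUnitBall hκprob fun f ↦ ?_
    refine measurable_of_tendsto_metrizable
      (f := fun n x ↦ if x ∈ E then I f n x else f.1 y₀)
      (fun n ↦ Measurable.ite hEm (hI f n) measurable_const) (tendsto_pi_nhds.2 fun x ↦ ?_)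
    by_cases hx : x ∈ E
    · simpa only [hx, if_true] using hκE x hx f
    · simp [hx, hκE' x hx]
  let η : Kernel X Y := ⟨κ, hκm⟩
  have : IsMarkovKernel η := ⟨hκprob⟩
  refine ⟨ρ ⊗ₘ η, inferInstance, Measure.fst_compProd _ _, fun g hg ↦ ?_⟩
  rw [Measure.integral_compProd (integrable_of_abs_le hg.measurable hg.abs_le_one)]
  simp_rw [integral_eq_integral_integral_condKernel (μ := μ _) hg, hfst]
  refine tendsto_integral_of_dominated_convergence (fun _ ↦ 1) (fun n ↦ ?_) (integrable_const _)
    (fun n ↦ Eventually.of_forall fun x ↦ ?_) ?_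
  · exact hg.measurable.stronglyMeasurable.integral_kernel_prod_right'.aestronglyMeasurable
  · refine (norm_integral_le_of_norm_le_const
      (Eventually.of_forall fun y ↦ hg.abs_le_one (x, y))).trans ?_
    simp
  · filter_upwards [hEae] with x hx
    exact hκE x hx ⟨⟨fun y ↦ g (x, y), (hg.lipschitz x).continuous⟩, hg.lipschitz x,
      fun y ↦ hg.abs_le_one _⟩

/-- An invariant probability measure of the base map lifts to an invariant probability measure of
the skew product. -/
theorem exists_invariant_lift [IsProbabilityMeasure ρ] (hT : Measurable T) (hG : Measurable G)
    (hd : ∀ y y' : Y, dist y y' ≤ 1) {α : ℝ} (hα0 : 0 < α) (hα1 : α < 1)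
    (hcon : ∀ x y₁ y₂, dist (G (x, y₁)) (G (x, y₂)) ≤ α * dist y₁ y₂) (hρ : ρ.map T = ρ) :
    ∃ μ₀ : Measure (X × Y), IsProbabilityMeasure μ₀ ∧ μ₀.fst = ρ ∧
      μ₀.map (skewProduct T G) = μ₀ := by
  obtain ⟨y₀⟩ := id ‹Nonempty Y›
  have hF := measurable_skewProduct hT hG
  let μ : ℕ → Measure (X × Y) := fun n ↦
    (fun ν ↦ ν.map (skewProduct T G))^[n] (ρ.prod (Measure.dirac y₀))
  have hμsucc : ∀ n, μ (n + 1) = (μ n).map (skewProduct T G) := fun n ↦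
    Function.iterate_succ_apply' _ _ _
  have hprob : ∀ n, IsProbabilityMeasure (μ n) := fun n ↦ by
    induction n with
    | zero => exact inferInstanceAs (IsProbabilityMeasure (ρ.prod (Measure.dirac y₀)))
    | succ n ih => rw [hμsucc]; exact Measure.isProbabilityMeasure_map hF.aemeasurable
  have hfst : ∀ n, (μ n).fst = ρ := fun n ↦ by
    induction n with
    | zero => exact Measure.fst_prod
    | succ n ih => rw [hμsucc, fst_map_skewProduct hT hG, ih, hρ]
  have hcauchy : ∀ n g, IsTestFunction g →
      |∫ p, g p ∂μ (n + 1) - ∫ p, g p ∂μ n| ≤ α ^ n * 2 := fun n ↦ by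
    induction n with
    | zero =>
      intro g hg
      have h1 : ∀ n, |∫ p, g p ∂μ n| ≤ 1 := fun n ↦ by
        have h2 := norm_integral_le_of_norm_le_const (μ := μ n) (f := g) (C := 1)
          (Eventually.of_forall hg.abs_le_one)
        simpa using h2
      rw [pow_zero, one_mul]
      refine (abs_sub _ _).trans ?_
      linarith [h1 0, h1 1]
    | succ n ih =>
      intro g hg
      have := abs_integral_map_sub_le hT hG hd hα0 hcon ((hfst (n + 1)).trans (hfst n).symm) ih hg
      rw [← hμsucc, ← hμsucc] at this
      rwa [pow_succ', mul_assoc]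
  obtain ⟨μ₀, hμ₀, hμ₀fst, hμ₀lim⟩ := exists_tendsto_integral_testFunction μ hfst hα0 hα1 hcauchy
  have := Measure.isProbabilityMeasure_map (μ := μ₀) hF.aemeasurable
  refine ⟨μ₀, hμ₀, hμ₀fst, ext_of_forall_integral_testFunction fun g hg ↦ ?_⟩
  rw [integral_map hF.aemeasurable hg.measurable.aestronglyMeasurable]
  -- Since `g ∘ F` is again a test function, `∫ g ∘ F dμ_n = ∫ g dμ_{n+1}` converges both to `∫ g ∘
  -- F dμ₀` and to `∫ g dμ₀`.
  refine tendsto_nhds_unique (hμ₀lim _ (hg.comp_skewProduct_of_le_one hT hG hα1.le hcon)) ?_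
  refine ((hμ₀lim g hg).comp (tendsto_add_atTop_nat 1)).congr fun n ↦ ?_
  rw [Function.comp_apply, hμsucc, integral_map hF.aemeasurable
    hg.measurable.aestronglyMeasurable]

end InvariantMeasure

/-! ### The transfer operator on `S¹` -/

section StrongSpaceOfMeasures

variable {X Y : Type*} [MeasurableSpace X] {m : Measure X} [SigmaFinite m]
  [MetricSpace Y] [CompactSpace Y] [Nonempty Y] [MeasurableSpace Y] [BorelSpace Y]
  {B : Type*} [NormedAddCommGroup B] [NormedSpace ℝ B] {ι : B →ₗ[ℝ] Lp ℝ 1 m}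

theorem S1.hasACMarginals (μ : S1 Y ι) : HasACMarginals m (μ : SignedMeasure (X × Y)) := μ.2.1

theorem S1.density_eq (hι : Function.Injective ι) {μ : S1 Y ι} {f : B}
    (hf : (ι f : X → ℝ) =ᵐ[m] marginalDensity m (μ : SignedMeasure (X × Y))) :
    S1.density μ = f :=
  hι (Lp.ext ((S1.density_spec μ).trans hf.symm))

theorem S1.density_add (hι : Function.Injective ι) (μ ν : S1 Y ι) :
    S1.density (μ + ν) = S1.density μ + S1.density ν := by
  refine S1.density_eq hι ?_
  rw [map_add]
  exact (Lp.coeFn_add _ _).trans (((S1.density_spec μ).add (S1.density_spec ν)).trans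
    (marginalDensity_add (S1.hasACMarginals μ) (S1.hasACMarginals ν)).symm)

theorem S1.density_smul (hι : Function.Injective ι) (c : ℝ) (μ : S1 Y ι) :
    S1.density (c • μ) = c • S1.density μ := by
  refine S1.density_eq hι ?_
  rw [map_smul]
  exact (Lp.coeFn_smul _ _).trans (((S1.density_spec μ).const_smul c).trans
    (marginalDensity_smul c (S1.hasACMarginals μ)).symm)

theorem S1.norm_nonneg (μ : S1 Y ι) : 0 ≤ S1.norm μ :=
  add_nonneg (_root_.norm_nonneg _) ENNReal.toReal_nonneg

theorem S1.norm_density_le (μ : S1 Y ι) : ‖S1.density μ‖ ≤ S1.norm μ :=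
  le_add_of_nonneg_right ENNReal.toReal_nonneg

theorem S1.toReal_weakNorm_le_norm (μ : S1 Y ι) :
    (weakNorm m (μ : SignedMeasure (X × Y))).toReal ≤ S1.norm μ :=
  le_add_of_nonneg_left (_root_.norm_nonneg _)

theorem S1.norm_add_smul_le (hι : Function.Injective ι) (c : ℝ) (μ ν : S1 Y ι) :
    S1.norm (μ + c • ν) ≤ S1.norm μ + |c| * S1.norm ν := by
  have h1 := toReal_weakNorm_add_smul_le (S1.hasACMarginals μ) (S1.hasACMarginals ν) c
  have h2 : ‖S1.density (μ + c • ν)‖ ≤ ‖S1.density μ‖ + |c| * ‖S1.density ν‖ := by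
    rw [S1.density_add hι, S1.density_smul hι, ← Real.norm_eq_abs, ← norm_smul]
    exact norm_add_le _ _
  calc _ ≤ ‖S1.density μ‖ + |c| * ‖S1.density ν‖ +
        ((weakNorm m μ.1).toReal + |c| * (weakNorm m ν.1).toReal) := add_le_add h2 h1
    _ = _ := by rw [S1.norm, S1.norm]; ring

variable (ι Y) in
/-- The total mass, as a linear functional on `S¹`. -/
def S1.mass : S1 Y ι →ₗ[ℝ] ℝ where
  toFun μ := (μ : SignedMeasure (X × Y)) univ
  map_add' _ _ := rfl
  map_smul' _ _ := rfl

theorem S1.mass_apply (μ : S1 Y ι) : S1.mass Y ι μ = (μ : SignedMeasure (X × Y)) univ := rfl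

/-- This links the two levels: elements of zero mass have marginals of zero average, to which the
decay of `L` applies. -/
theorem S1.average_density (μ : S1 Y ι) : average ι (S1.density μ) = S1.mass Y ι μ := by
  have h := setIntegral_marginalDensity (S1.hasACMarginals μ) (MeasurableSet.univ (α := X))
  rw [average_apply, integral_congr_ae (S1.density_spec μ), S1.mass_apply]
  simpa using h

theorem S1.integral_abs_marginalDensity (μ : S1 Y ι) :
    ∫ x, |marginalDensity m (μ : SignedMeasure (X × Y)) x| ∂m = ‖ι (S1.density μ)‖ := by
  rw [L1.norm_eq_integral_norm]
  exact integral_congr_ae ((S1.density_spec μ).mono fun x hx ↦ by simp only [hx, Real.norm_eq_abs])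

variable {T : X → X} {G : X × Y → Y} {L : B →L[ℝ] B}

/-- The transfer operator of the skew product on `S¹`. -/
def transferOperator (hT : Measurable T) (hG : Measurable G)
    (hns : ∀ A : Set X, MeasurableSet A → m A = 0 → m (T ⁻¹' A) = 0)
    (hL : ∀ f : B, ι (L f) = perronFrobenius m T (ι f)) : S1 Y ι →ₗ[ℝ] S1 Y ι where
  toFun μ := ⟨(μ : SignedMeasure (X × Y)).map (skewProduct T G), (S1.hasACMarginals μ).map hT hG hns,
    weakNorm_lt_top m _, L (S1.density μ), by
      rw [hL]
      exact perronFrobenius_ae_eq hT hG hns (S1.hasACMarginals μ) (S1.density_spec μ)⟩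
  map_add' _ _ := Subtype.ext (VectorMeasure.map_add _ _ _)
  map_smul' c _ := Subtype.ext (VectorMeasure.map_smul c)

/-! ### Invariant element and decay on zero mass -/

section Transfer

variable (hT : Measurable T) (hG : Measurable G)
  (hns : ∀ A : Set X, MeasurableSet A → m A = 0 → m (T ⁻¹' A) = 0)
  (hL : ∀ f : B, ι (L f) = perronFrobenius m T (ι f))

theorem coe_transferOperator (μ : S1 Y ι) :
    (transferOperator hT hG hns hL μ : SignedMeasure (X × Y)) =
      (μ : SignedMeasure (X × Y)).map (skewProduct T G) := rfl

theorem mass_transferOperator (μ : S1 Y ι) :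
    S1.mass Y ι (transferOperator hT hG hns hL μ) = S1.mass Y ι μ := by
  rw [S1.mass_apply, S1.mass_apply, coe_transferOperator,
    VectorMeasure.map_apply _ (measurable_skewProduct hT hG) MeasurableSet.univ, preimage_univ]

theorem density_transferOperator (hι : Function.Injective ι) (μ : S1 Y ι) :
    S1.density (transferOperator hT hG hns hL μ) = L (S1.density μ) := by
  refine S1.density_eq hι ?_
  rw [hL]
  exact perronFrobenius_ae_eq hT hG hns (S1.hasACMarginals μ) (S1.density_spec μ)

theorem density_transferOperator_pow (hι : Function.Injective ι) (n : ℕ) (μ : S1 Y ι) :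
    S1.density ((transferOperator hT hG hns hL ^ n) μ) = (L ^ n) (S1.density μ) := by
  induction n with
  | zero => simp
  | succ n ih =>
    rw [pow_succ', pow_succ', Module.End.mul_apply, density_transferOperator hT hG hns hL hι, ih]
    rfl

/-- An invariant density of the base map gives an invariant element of `S¹`. -/
theorem exists_invariant_mem_S1 (hd : ∀ y y' : Y, dist y y' ≤ 1) {α : ℝ} (hα0 : 0 < α)
    (hα1 : α < 1) (hcon : ∀ x y₁ y₂, dist (G (x, y₁)) (G (x, y₂)) ≤ α * dist y₁ y₂) {ψ : B}
    (hψ : IsDensity ι ψ) (hLψ : L ψ = ψ) :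
    ∃ μ₀ : S1 Y ι, transferOperator hT hG hns hL μ₀ = μ₀ ∧ S1.mass Y ι μ₀ = 1 := by
  set φ : X → ℝ := ⇑(ι ψ) with hφ
  have hφi : Integrable φ m := L1.integrable_coeFn _
  have hφ0 : 0 ≤ᵐ[m] φ := (Lp.coeFn_nonneg _).2 hψ.1
  set ρ : Measure X := m.withDensity fun x ↦ ENNReal.ofReal (φ x) with hρ
  have hρA : ∀ A, MeasurableSet A → ρ A = ENNReal.ofReal (∫ x in A, φ x ∂m) := fun A hA ↦ by
    rw [hρ, withDensity_apply _ hA, ofReal_integral_eq_lintegral_ofReal hφi.integrableOn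
      (ae_restrict_of_ae hφ0)]
  have hρprob : IsProbabilityMeasure ρ := ⟨by
    rw [hρA _ MeasurableSet.univ, setIntegral_univ, ← average_apply, hψ.average_eq_one,
      ENNReal.ofReal_one]⟩
  have hρT : ρ.map T = ρ := by
    ext A hA
    rw [Measure.map_apply hT hA, hρA _ hA, hρA _ (hT hA), ← setIntegral_perronFrobenius hT hns _ hA,
      ← hL, hLψ]
  obtain ⟨μ, hμ, hfst, hinv⟩ := exists_invariant_lift hT hG hd hα0 hα1 hcon hρT
  have hac : HasACMarginals m μ.toSignedMeasure := by
    rw [hasACMarginals_iff]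
    intro A hA hmA E hE hEA
    have h1 : μ (Prod.fst ⁻¹' A) = 0 := by
      rw [← Measure.fst_apply hA, hfst]
      exact withDensity_absolutelyContinuous _ _ hmA
    rw [Measure.toSignedMeasure_apply_measurable hE, measureReal_def, measure_mono_null hEA h1,
      ENNReal.toReal_zero]
  have hdens : φ =ᵐ[m] marginalDensity m μ.toSignedMeasure := by
    refine Integrable.ae_eq_of_forall_setIntegral_eq _ _ hφi (integrable_marginalDensity _)
      fun A hA _ ↦ ?_
    rw [setIntegral_marginalDensity hac hA,
      Measure.toSignedMeasure_apply_measurable (measurable_fst hA), measureReal_def,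
      ← Measure.fst_apply hA, hfst, hρA A hA,
      ENNReal.toReal_ofReal (integral_nonneg_of_ae (ae_restrict_of_ae hφ0))]
  refine ⟨⟨μ.toSignedMeasure, hac, weakNorm_lt_top m _, ψ, hdens⟩, Subtype.ext ?_, ?_⟩
  · have hF := measurable_skewProduct hT hG
    rw [coe_transferOperator]
    ext E hE
    rw [VectorMeasure.map_apply _ hF hE, Measure.toSignedMeasure_apply_measurable hE,
      Measure.toSignedMeasure_apply_measurable (hF hE), measureReal_def, measureReal_def,
      ← Measure.map_apply hF hE, hinv]
  · rw [S1.mass_apply, Measure.toSignedMeasure_apply_measurable MeasurableSet.univ, probReal_univ]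

/-- The induction closes because `q = b / (ξ - α)` solves `α q + b = ξ q`. -/
theorem le_geometric_of_succ_le {w : ℕ → ℝ} {α b r ξ : ℝ} (hα : 0 ≤ α) (hb : 0 ≤ b) (hr : 0 ≤ r)
    (hαξ : α < ξ) (hrξ : r ≤ ξ) (hw0 : 0 ≤ w 0) (hw : ∀ n, w (n + 1) ≤ α * w n + b * r ^ n) (n : ℕ) :
    w n ≤ (w 0 + b / (ξ - α)) * ξ ^ n := by
  have hd : 0 < ξ - α := sub_pos.2 hαξ
  have hξ : 0 < ξ := hα.trans_lt hαξ
  induction n with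
  | zero => simpa using by positivity
  | succ n ih =>
    calc w (n + 1) ≤ α * ((w 0 + b / (ξ - α)) * ξ ^ n) + b * ξ ^ n := (hw n).trans (by gcongr)
      _ = (α * w 0 + ξ * (b / (ξ - α))) * ξ ^ n := by field_simp; ring
      _ ≤ (ξ * w 0 + ξ * (b / (ξ - α))) * ξ ^ n := by gcongr
      _ = _ := by ring

/-- The transfer operator contracts exponentially the elements of `S¹` of zero mass. -/
theorem norm_transferOperator_pow_le (hι : Function.Injective ι) (hle : ∀ f : B, ‖ι f‖ ≤ ‖f‖)
    (hd : ∀ y y' : Y, dist y y' ≤ 1) {α : ℝ} (hα0 : 0 < α)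
    (hcon : ∀ x y₁ y₂, dist (G (x, y₁)) (G (x, y₂)) ≤ α * dist y₁ y₂) {r D ξ : ℝ}
    (hdecay : ZeroAverageDecay ι L r D) (hαξ : α < ξ) (hrξ : r ≤ ξ) {μ : S1 Y ι}
    (hμ : S1.mass Y ι μ = 0) (n : ℕ) :
    S1.norm ((transferOperator hT hG hns hL ^ n) μ) ≤
      (D + 1 + D / (ξ - α)) * ξ ^ n * S1.norm μ := by
  obtain ⟨hr0, -, hD, hdec⟩ := hdecay
  have hξ : 0 < ξ := hα0.trans hαξ
  have hdξ : 0 < ξ - α := sub_pos.2 hαξ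
  set F := transferOperator hT hG hns hL
  set δ := ‖S1.density μ‖
  have h1 : ∀ n, ‖(L ^ n) (S1.density μ)‖ ≤ D * r ^ n * δ := hdec _ (by
    rw [← average_apply, S1.average_density, hμ])
  set w : ℕ → ℝ := fun n ↦ (weakNorm m ((F ^ n) μ : SignedMeasure (X × Y))).toReal with hw
  have h2 : ∀ n, w (n + 1) ≤ α * w n + D * δ * r ^ n := fun n ↦ by
    have h3 := toReal_weakNorm_map_le hT hG hns hd hα0 hcon (S1.hasACMarginals ((F ^ n) μ))
    rw [S1.integral_abs_marginalDensity, density_transferOperator_pow hT hG hns hL hι] at h3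
    have h4 : w (n + 1) = (weakNorm m (((F ^ n) μ : SignedMeasure (X × Y)).map
        (skewProduct T G))).toReal := by
      simp only [hw, pow_succ', Module.End.mul_apply]
      rfl
    rw [h4]
    linarith [hle ((L ^ n) (S1.density μ)), h1 n]
  have h3 := le_geometric_of_succ_le hα0.le (by positivity) hr0.le hαξ hrξ
    ENNReal.toReal_nonneg h2 n
  have h4 : w 0 ≤ S1.norm μ := S1.toReal_weakNorm_le_norm μ
  have h5 : δ ≤ S1.norm μ := S1.norm_density_le μ
  have h6 : S1.norm ((F ^ n) μ) = ‖(L ^ n) (S1.density μ)‖ + w n := by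
    rw [S1.norm, density_transferOperator_pow hT hG hns hL hι]
  rw [h6]
  -- In the constant, `D` comes from the marginal, `1` from the initial weak norm, and `D / (ξ - α)`
  -- from the accumulated marginal errors.
  calc _ ≤ D * ξ ^ n * S1.norm μ + (S1.norm μ + D * S1.norm μ / (ξ - α)) * ξ ^ n := by
        refine add_le_add ((h1 n).trans (by gcongr)) (h3.trans (by gcongr))
    _ = _ := by ring

end Transfer

end StrongSpaceOfMeasures

/-! ### The spectral gap -/

section SpectralGap

/-- Since `a < √a < 1` on `(0, 1)`, taking square roots leaves room above `α` and `r`. The strict `α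
< ξ` is needed for the denominator `ξ - α`. -/
theorem rate_bounds {α r l : ℝ} (hα0 : 0 < α) (hα1 : α < 1) (hr0 : 0 < r) (hr1 : r < 1)
    (hl : l < 1) : α < √(max l (max √α √r)) ∧ r ≤ √(max l (max √α √r)) ∧
      √(max l (max √α √r)) < 1 := by
  have key : ∀ a : ℝ, 0 < a → a < 1 → a < √a ∧ √a < 1 := fun a h0 h1 ↦
    ⟨Real.lt_sqrt_of_sq_lt (by nlinarith), by rw [Real.sqrt_lt' one_pos]; simpa using h1⟩
  obtain ⟨ha, ha'⟩ := key α hα0 hα1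
  obtain ⟨hr, hr'⟩ := key r hr0 hr1
  have hm0 : 0 < max l (max √α √r) := lt_max_of_lt_right (lt_max_of_lt_left (hα0.trans ha))
  have hm1 : max l (max √α √r) < 1 := max_lt hl (max_lt ha' hr')
  obtain ⟨hm, hm'⟩ := key _ hm0 hm1
  exact ⟨(ha.trans_le ((le_max_left _ _).trans (le_max_right _ _))).trans hm,
    ((hr.trans_le ((le_max_right _ _).trans (le_max_right _ _))).trans hm).le, hm'⟩

theorem finrank_range_smulRight {V : Type*} [AddCommMonoid V] [Module ℝ V] {f : V →ₗ[ℝ] ℝ} {v : V}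
    (hv : f v = 1) : Module.finrank ℝ (LinearMap.range (f.smulRight v)) = 1 := by
  have hf : ∀ w : LinearMap.range (f.smulRight v), f w.1 • v = w.1 := by
    rintro ⟨_, w, rfl⟩
    simp [hv]
  have hbij : Function.Bijective (f ∘ₗ (LinearMap.range (f.smulRight v)).subtype) := by
    refine ⟨fun w w' h ↦ Subtype.ext ?_, fun c ↦ ⟨⟨c • v, c • v, by simp [hv]⟩, by simp [hv]⟩⟩
    rw [← hf w, ← hf w']
    exact congrArg (· • v) h
  rw [(LinearEquiv.ofBijective _ hbij).finrank_eq, Module.finrank_self]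

/-- The spectral gap on `S¹` of the transfer operator of a fibre contracting skew product over a
nonsingular map of a probability space. -/
theorem spectralGap {X Y : Type*} [MeasurableSpace X] {m : Measure X} [IsProbabilityMeasure m]
    [MetricSpace Y] [CompactSpace Y] [Nonempty Y] [MeasurableSpace Y] [BorelSpace Y]
    (hd : ∀ y y' : Y, dist y y' ≤ 1) {T : X → X} (hT : Measurable T) {G : X × Y → Y}
    (hG : Measurable G) {α : ℝ} (hα0 : 0 < α) (hα1 : α < 1)
    (hcon : ∀ x y₁ y₂, dist (G (x, y₁)) (G (x, y₂)) ≤ α * dist y₁ y₂)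
    (hns : ∀ A : Set X, MeasurableSet A → m A = 0 → m (T ⁻¹' A) = 0)
    {B : Type*} [NormedAddCommGroup B] [NormedSpace ℝ B] {ι : B →ₗ[ℝ] Lp ℝ 1 m}
    (hι : Function.Injective ι) (hle : ∀ f : B, ‖ι f‖ ≤ ‖f‖) {L : B →L[ℝ] B}
    (hL : ∀ f : B, ι (L f) = perronFrobenius m T (ι f))
    (hcomp : IsCompact (closure (ι '' Metric.closedBall (0 : B) 1)))
    {k : ℕ} (hk : 1 ≤ k) {β C : ℝ} (hβ0 : 0 < β) (hβ1 : β < 1) (hC : 0 < C)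
    (hLY : ∀ f : B, ‖(L ^ k) f‖ ≤ β * ‖f‖ + C * ‖ι f‖) {ψ₀ : B} (hψ₀ : IsDensity ι ψ₀)
    (hLψ : L ψ₀ = ψ₀)
    (hconv : ∀ ψ : B, IsDensity ι ψ → Tendsto (fun n : ℕ ↦ (L ^ n) (ψ₀ - ψ)) atTop (𝓝 0))
    (hS : Dense (Submodule.span ℝ {f : B | 0 ≤ ι f} : Set B)) :
    ∃ F P N : S1 Y ι →ₗ[ℝ] S1 Y ι,
      (∀ μ, (F μ : SignedMeasure (X × Y)) =
        (μ : SignedMeasure (X × Y)).map (skewProduct T G)) ∧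
      F = P + N ∧ P ∘ₗ P = P ∧ Module.finrank ℝ (LinearMap.range P) = 1 ∧
      P ∘ₗ N = 0 ∧ N ∘ₗ P = 0 ∧ (∃ r D : ℝ, ZeroAverageDecay ι L r D) ∧
      ∀ r D : ℝ, ZeroAverageDecay ι L r D →
        ∃ ξ K : ℝ, ξ = √(max (β ^ (1 / (k : ℝ))) (max √α √r)) ∧ 0 < ξ ∧ ξ < 1 ∧ 0 < K ∧
          ∀ (n : ℕ) (μ : S1 Y ι), S1.norm ((N ^ n) μ) ≤ K * ξ ^ n * S1.norm μ := by
  obtain ⟨μ₀, hFμ₀, hμ₀⟩ := exists_invariant_mem_S1 hT hG hns hL hd hα0 hα1 hcon hψ₀ hLψ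
  set F := transferOperator hT hG hns hL
  set P : S1 Y ι →ₗ[ℝ] S1 Y ι := (S1.mass Y ι).smulRight μ₀
  set N : S1 Y ι →ₗ[ℝ] S1 Y ι := F + (-1 : ℝ) • P
  have hP : ∀ μ, P μ = S1.mass Y ι μ • μ₀ := fun μ ↦ rfl
  have hN : ∀ μ, N μ = F μ + (-1 : ℝ) • S1.mass Y ι μ • μ₀ := fun μ ↦ rfl
  have hmass : ∀ μ, S1.mass Y ι (F μ) = S1.mass Y ι μ := mass_transferOperator hT hG hns hL
  -- On zero mass `P` vanishes and `N` acts as `F`; one application of `N` removes the component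
  -- along `μ₀`. The exponent must be positive, as `N ^ 0` is the identity.
  have hNpow : ∀ (n : ℕ) μ,
      (N ^ (n + 1)) μ = (F ^ (n + 1)) (μ + (-S1.mass Y ι μ) • μ₀) := fun n μ ↦ by
    have hz : ∀ n, S1.mass Y ι ((F ^ n) (μ + (-S1.mass Y ι μ) • μ₀)) = 0 := fun n ↦ by
      induction n with
      | zero => simp [hμ₀]
      | succ n ih => rw [pow_succ', Module.End.mul_apply, hmass, ih]
    induction n with
    | zero =>
      rw [zero_add, pow_one, pow_one, hN, map_add, map_smul, hFμ₀]
      module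
    | succ n ih =>
      rw [pow_succ', Module.End.mul_apply, ih, hN, hz, zero_smul, smul_zero, add_zero,
        ← Module.End.mul_apply, ← pow_succ']
  have hcontr : ∀ f : B, ‖ι (L f)‖ ≤ ‖ι f‖ := fun f ↦ by
    rw [hL]
    exact norm_perronFrobenius_le hT hns _
  have hint : ∀ f : B, average ι (L f) = average ι f := fun f ↦ by
    rw [average_apply, average_apply, hL, integral_perronFrobenius hT hns]
  refine ⟨F, P, N, coe_transferOperator hT hG hns hL, LinearMap.ext fun μ ↦ ?_,
    LinearMap.ext fun μ ↦ ?_, finrank_range_smulRight hμ₀, LinearMap.ext fun μ ↦ ?_,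
    LinearMap.ext fun μ ↦ ?_,
    exists_zeroAverageDecay hι hle hcontr hint hcomp hk hβ0 hβ1 hC hLY hLψ hconv hS,
    fun r D hdecay ↦ ?_⟩
  · rw [LinearMap.add_apply, hN, hP]
    module
  · rw [LinearMap.comp_apply, hP, hP, map_smul, hμ₀, smul_eq_mul, mul_one]
  · rw [LinearMap.comp_apply, hP, hN, map_add, map_smul, map_smul, hμ₀, hmass]
    simp
  · rw [LinearMap.comp_apply, hN, hP, map_smul, map_smul, hFμ₀, hμ₀, smul_eq_mul, mul_one,
      LinearMap.zero_apply]
    module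
  have hl : β ^ (1 / (k : ℝ)) < 1 := by
    have : (0 : ℝ) < k := by exact_mod_cast hk
    exact Real.rpow_lt_one hβ0.le hβ1 (by positivity)
  obtain ⟨hαξ, hrξ, hξ1⟩ := rate_bounds hα0 hα1 hdecay.1 hdecay.2.1 hl
  set ξ := √(max (β ^ (1 / (k : ℝ))) (max √α √r))
  have hξ0 : 0 < ξ := hα0.trans hαξ
  have hD : 0 < D := hdecay.2.2.1
  have hd0 : 0 < ξ - α := sub_pos.2 hαξ
  have hμ₀n := S1.norm_nonneg μ₀
  -- The factor `1 + S1.norm μ₀` pays for subtracting the mass times `μ₀`; `K ≥ 1` settles `n = 0`.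
  set K := (D + 1 + D / (ξ - α)) * (1 + S1.norm μ₀) with hK
  have hK1 : 1 ≤ K := by
    have h1 : 0 < D / (ξ - α) := by positivity
    nlinarith
  refine ⟨ξ, K, rfl, hξ0, hξ1, one_pos.trans_le hK1, fun n μ ↦ ?_⟩
  rcases n with _ | n
  · simpa using le_mul_of_one_le_left (S1.norm_nonneg μ) hK1
  rw [hNpow]
  have h2 : S1.mass Y ι (μ + (-S1.mass Y ι μ) • μ₀) = 0 := by simp [hμ₀]
  have h3 : |-S1.mass Y ι μ| ≤ S1.norm μ := by
    rw [abs_neg, ← S1.average_density]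
    exact (abs_average_le _).trans ((hle _).trans (S1.norm_density_le μ))
  calc _ ≤ (D + 1 + D / (ξ - α)) * ξ ^ (n + 1) * S1.norm (μ + (-S1.mass Y ι μ) • μ₀) :=
        norm_transferOperator_pow_le hT hG hns hL hι hle hd hα0 hcon hdecay hαξ hrξ h2 _
    _ ≤ (D + 1 + D / (ξ - α)) * ξ ^ (n + 1) * (S1.norm μ + S1.norm μ * S1.norm μ₀) := by
        gcongr
        exact (S1.norm_add_smul_le hι _ _ _).trans (by gcongr)
    _ = K * ξ ^ (n + 1) * S1.norm μ := by rw [hK]; ring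

/-- Normalization alone only gives mass at most one, since the volume could be zero or infinite; the
branch domains having total mass one forces equality. -/
theorem IsPiecewiseDiffeo.isProbabilityMeasure {n : ℕ} {H : Type*} [TopologicalSpace H]
    {I : ModelWithCorners ℝ (EuclideanSpace ℝ (Fin n)) H} {M : Type*} [TopologicalSpace M]
    [ChartedSpace H M] [RiemannianBundle (fun x : M ↦ TangentSpace I x)] [MeasurableSpace M]
    {T : M → M} (hT : IsPiecewiseDiffeo I T) : IsProbabilityMeasure (normalizedVolume I M) := by
  obtain ⟨q, P, -, hP, -⟩ := hT
  refine ⟨le_antisymm ?_ (hP ▸ measure_mono (subset_univ _))⟩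
  simp only [normalizedVolume, Measure.smul_apply, smul_eq_mul]
  exact ENNReal.inv_mul_le_one (riemannianVolume I M univ)

end SpectralGap

end SkewProduct

end

theorem theorem6p1
    -- the Riemannian manifolds `N₁`, `N₂` (possibly with boundary), compact, `diam N₂ = 1`
    {n₁ n₂ : ℕ} {H₁ H₂ : Type*} [TopologicalSpace H₁] [TopologicalSpace H₂]
    (I₁ : ModelWithCorners ℝ (EuclideanSpace ℝ (Fin n₁)) H₁)
    (I₂ : ModelWithCorners ℝ (EuclideanSpace ℝ (Fin n₂)) H₂)
    {N₁ N₂ : Type*}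
    [TopologicalSpace N₁] [T2Space N₁] [CompactSpace N₁] [ChartedSpace H₁ N₁]
    [IsManifold I₁ ∞ N₁] [RiemannianBundle (fun x : N₁ ↦ TangentSpace I₁ x)]
    [IsContMDiffRiemannianBundle I₁ ∞ (EuclideanSpace ℝ (Fin n₁))
      (fun x : N₁ ↦ TangentSpace I₁ x)]
    [MeasurableSpace N₁] [BorelSpace N₁]
    [MetricSpace N₂] [CompactSpace N₂] [Nonempty N₂] [ChartedSpace H₂ N₂]
    [IsManifold I₂ ∞ N₂] [RiemannianBundle (fun x : N₂ ↦ TangentSpace I₂ x)]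
    [IsContMDiffRiemannianBundle I₂ ∞ (EuclideanSpace ℝ (Fin n₂))
      (fun x : N₂ ↦ TangentSpace I₂ x)]
    [IsRiemannianManifold I₂ N₂] [MeasurableSpace N₂] [BorelSpace N₂]
    (hdiam : Metric.diam (univ : Set N₂) = 1)
    -- the skew product
    (T : N₁ → N₁) (hT : Measurable T) (G : N₁ × N₂ → N₂) (hG : Measurable G)
    -- G1: the fibres are uniformly contracted
    (α : ℝ) (hα₀ : 0 < α) (hα₁ : α < 1)
    (hG1 : ∀ x y₁ y₂, dist (G (x, y₁)) (G (x, y₂)) ≤ α * dist y₁ y₂)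
    -- T1: `T` is nonsingular
    (hT1 : ∀ A : Set N₁, MeasurableSet A → SkewProduct.normalizedVolume I₁ N₁ A = 0 →
      SkewProduct.normalizedVolume I₁ N₁ (T ⁻¹' A) = 0)
    -- T2: `T` is piecewise a diffeomorphism
    (hT2 : SkewProduct.IsPiecewiseDiffeo I₁ T)
    -- the Banach space `S_`, embedded in `L¹` by `ι`
    {B : Type*} [NormedAddCommGroup B] [NormedSpace ℝ B] [CompleteSpace B]
    (ι : B →ₗ[ℝ] Lp ℝ 1 (SkewProduct.normalizedVolume I₁ N₁)) (hι : Function.Injective ι)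
    -- T3.1: `|·|₁ ≤ |·|_s`, and `P_T` restricts to a bounded operator `L` of `S_`
    (hT31 : ∀ f : B, ‖ι f‖ ≤ ‖f‖) (L : B →L[ℝ] B)
    (hL : ∀ f : B, ι (L f) =
      SkewProduct.perronFrobenius (SkewProduct.normalizedVolume I₁ N₁) T (ι f))
    -- T3.2: the unit ball of `S_` is relatively compact in `L¹`
    (hT32 : IsCompact (closure (ι '' Metric.closedBall (0 : B) 1)))
    -- T3.3: Lasota–Yorke inequality
    (k : ℕ) (hk : 1 ≤ k) (β₀ : ℝ) (hβ₀ : 0 < β₀) (hβ₁ : β₀ < 1) (C : ℝ) (hC : 0 < C)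
    (hT33 : ∀ f : B, ‖(L ^ k) f‖ ≤ β₀ * ‖f‖ + C * ‖ι f‖)
    -- T3.4: unique invariant density, attracting all densities in `S_`
    (hT34 : ∃ ψ₀ : B, SkewProduct.IsDensity ι ψ₀ ∧ L ψ₀ = ψ₀ ∧
      (∀ ψ : B, SkewProduct.IsDensity ι ψ → L ψ = ψ → ψ = ψ₀) ∧
      ∀ ψ : B, SkewProduct.IsDensity ι ψ →
        Tendsto (fun n : ℕ ↦ (L ^ n) (ψ₀ - ψ)) atTop (𝓝 0))
    -- the nonnegative elements of `S_` span a dense subspace of `S_`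
    (hS : Dense (Submodule.span ℝ {f : B | 0 ≤ ι f} : Set B)) :
    ∃ F P N : SkewProduct.S1 N₂ ι →ₗ[ℝ] SkewProduct.S1 N₂ ι,
      -- `F` is the transfer operator, which maps `S¹` to itself
      (∀ μ, (F μ : SignedMeasure (N₁ × N₂)) =
        (μ : SignedMeasure (N₁ × N₂)).map (SkewProduct.skewProduct T G)) ∧
      F = P + N ∧
      P ∘ₗ P = P ∧ Module.finrank ℝ (LinearMap.range P) = 1 ∧
      P ∘ₗ N = 0 ∧ N ∘ₗ P = 0 ∧
      -- there is a rate `r` of contraction on the zero average functions of `S_`, and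
      -- every such rate gives the explicit rate `ξ` for `N`
      (∃ r D : ℝ, SkewProduct.ZeroAverageDecay ι L r D) ∧
      ∀ r D : ℝ, SkewProduct.ZeroAverageDecay ι L r D →
        ∃ ξ K : ℝ, ξ = √(max (β₀ ^ (1 / (k : ℝ))) (max √α √r)) ∧ 0 < ξ ∧ ξ < 1 ∧ 0 < K ∧
          ∀ (n : ℕ) (μ : SkewProduct.S1 N₂ ι),
            SkewProduct.S1.norm ((N ^ n) μ) ≤ K * ξ ^ n * SkewProduct.S1.norm μ := by
  obtain ⟨ψ₀, hψ₀, hLψ, -, hconv⟩ := hT34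
  have := hT2.isProbabilityMeasure
  exact SkewProduct.spectralGap (fun y y' ↦ hdiam ▸ Metric.dist_le_diam_of_mem
    isCompact_univ.isBounded (mem_univ y) (mem_univ y')) hT hG hα₀ hα₁ hG1 hT1 hι hT31 hL hT32 hk
    hβ₀ hβ₁ hC hT33 hψ₀ hLψ hconv hS
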